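/- Let $n\ge 0$ and $f:\{0,1\}^n\times\{0,1\}^n\to\{0,1\}$. All systems are finite-dimensional, $\log=\log_2$, and $\|\mathcal N-\mathcal M\|_\diamond=\sup_d\max_{\rho}\|(\mathrm{id}_d\otimes\mathcal N)(\rho)-(\mathrm{id}_d\otimes\mathcal M)(\rho)\|_1$, where $\rho$ ranges over density matrices. **CDQS.** A CDQS protocol for $f$ with a one-qubit secret $Q$ consists of a density matrix $\Psi_{LR}$ shared by Alice (who holds $L$) and Bob (who holds $R$) and of channels $\mathcal N^x_{QL\to M_A}$ of Alice and $\mathcal N^y_{R\to M_B}$ of Bob. Put $M=M_AM_B$ and $\mathcal N^{x,y}_{Q\to M}(\cdot)=(\mathcal N^x\otimes\mathcal N^y)(\,\cdot\otimes\Psi_{LR})$. The protocol is $\epsilon$-correct if for all $(x,y)\in f^{-1}(1)$ there is a channel $\mathcal D^{x,y}_{M\to Q}$ with $\|\mathcal D^{x,y}\circ\mathcal N^{x,y}-\mathcal I_Q\|_\diamond\le\epsilon$, and $\delta$-secure if for all $(x,y)\in f^{-1}(0)$ there is a density matrix $\sigma^{x,y}$ on $M$ with $\|\sigma^{x,y}\,\mathrm{tr}_Q(\cdot)-\mathcal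 N^{x,y}\|_\diamond\le\delta$. Let $\overline{\mathrm{CDQS}}(f)$ be the infimum of $\log\dim L+\log\dim R+\log\dim M_A+\log\dim M_B$ over all protocols for $f$ that are $0.09$-correct and $0.09$-secure. **QAM[2,2].** In a two-prover, two-message, public-coin proof for $f$, Alice holds $x$, Bob holds $y$, and they share a pure state $|\Psi\rangle_{LR}$ independent of $x,y$. Two provers know $x,y$ and share a state $\varphi^{x,y}_{PP'}$. Alice sends uniformly random bits $r$ to prover 1 only. Prover 1 applies a channel, which may depend on $r$, to $P$ and sends $M_A$ to Alice and $M_B$ to Bob; prover 2 applies a channel to $P'$ and sends $M_A'$ to Alice and $M_B'$ to Bob. Then Alice (whose operations may depend on $x,r$) and Bob (whose operations may depend on $y$) apply local operations and exchange finitely many quantum messages, after which Alice accepts or rejects. The proof is $\epsilon$-correct if for every $(x,y)\in f^{-1}(1)$ some strategy of the provers makes Alice accept with probability at least $1-\epsilon$, and $\delta$-secure if for every $(x,y)\in f^{-1}(0)$ every strategy of the provers makes Alice accept with probability at most $\delta$. Its cost is $\log\dim M_A+\log\dim M_B+\log\dim M_A'+\log\dim M_B'$ plus the sum of $\log\dim$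 over the messages exchanged by Alice and Bob; $\mathsf{QAM}[2,2]^{cc}_{\epsilon,\delta}(f)$ is the infimum of the cost over all $\epsilon$-correct and $\delta$-secure proofs for $f$. **Theorem.** For any fixed $\epsilon_p,\delta_p\in(0,1)$ there are constants $a=a(\epsilon_p,\delta_p)>0$ and $c=c(\epsilon_p,\delta_p)\ge 0$ such that for all $n$ and all $f:\{0,1\}^n\times\{0,1\}^n\to\{0,1\}$, $$\overline{\mathrm{CDQS}}(f)\;\ge\; a\cdot\mathsf{QAM}[2,2]^{cc}_{\epsilon_p,\delta_p}(f)-c .$$ -/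

import Mathlib

open scoped Matrix Kronecker ENNReal ComplexOrder

noncomputable section

namespace QuantumCDS

/-- Bit strings of length `n`. -/
abbrev Bits (n : ℕ) : Type := Fin n → Bool

/-! ### States, channels, trace norm, diamond norm

A finite-dimensional quantum system with a fixed orthonormal basis is represented by the finite
type indexing that basis. -/

/-- Density matrices. -/
def IsDensity {ι : Type} [Fintype ι] (ρ : Matrix ι ι ℂ) : Prop :=
  ρ.PosSemidef ∧ ρ.trace = 1

/-- Quantum channels, in operator-sum (Kraus) form. -/
def IsChannel {ι κ : Type} [Fintype ι] [DecidableEq ι] [Fintype κ]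
    (Φ : Matrix ι ι ℂ →ₗ[ℂ] Matrix κ κ ℂ) : Prop :=
  ∃ (m : ℕ) (K : Fin m → Matrix κ ι ℂ),
    (∀ X, Φ X = ∑ i, K i * X * (K i)ᴴ) ∧ ∑ i, (K i)ᴴ * K i = 1

/-- The type of quantum channels from the system `ι` to the system `κ`. -/
structure Channel (ι κ : Type) [Fintype ι] [DecidableEq ι] [Fintype κ] where
  toLin : Matrix ι ι ℂ →ₗ[ℂ] Matrix κ κ ℂ
  isChannel : IsChannel toLin

/-- `(id ⊗ Φ) X`, for a linear map `Φ` acting on the second tensor factor. -/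
def onRight {γ ι κ : Type} (Φ : Matrix ι ι ℂ →ₗ[ℂ] Matrix κ κ ℂ)
    (X : Matrix (γ × ι) (γ × ι) ℂ) : Matrix (γ × κ) (γ × κ) ℂ :=
  Matrix.of fun p q => Φ (Matrix.of fun i j => X (p.1, i) (q.1, j)) p.2 q.2

/-- `(Φ ⊗ id) X`, for a linear map `Φ` acting on the first tensor factor. -/
def onLeft {γ ι κ : Type} (Φ : Matrix ι ι ℂ →ₗ[ℂ] Matrix κ κ ℂ)
    (X : Matrix (ι × γ) (ι × γ) ℂ) : Matrix (κ × γ) (κ × γ) ℂ :=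
  Matrix.of fun p q => Φ (Matrix.of fun i j => X (i, p.2) (j, q.2)) p.1 q.1

/-- The trace norm `‖X‖₁`, the sum of the singular values of `X`. -/
def traceNorm {ι : Type} [Fintype ι] [DecidableEq ι] (X : Matrix ι ι ℂ) : ℝ :=
  ∑ i, Real.sqrt ((Matrix.isHermitian_conjTranspose_mul_self X).eigenvalues i)

/-- The diamond norm distance: the supremum, over all dimensions `d` of a reference system and all
density matrices `ρ` on reference and input, of `‖(id ⊗ Φ) ρ - (id ⊗ Ψ) ρ‖₁`. -/
def diamondDist {ι κ : Type} [Fintype ι] [Fintype κ] [DecidableEq κ]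
    (Φ Ψ : Matrix ι ι ℂ →ₗ[ℂ] Matrix κ κ ℂ) : ℝ≥0∞ :=
  ⨆ (d : ℕ) (ρ : Matrix (Fin d × ι) (Fin d × ι) ℂ) (_ : IsDensity ρ),
    ENNReal.ofReal (traceNorm (onRight Φ ρ - onRight Ψ ρ))

/-- The linear map `X ↦ tr(X) σ`: discard the input and prepare `σ`. -/
def discardPrepare {ι κ : Type} [Fintype ι] (σ : Matrix κ κ ℂ) :
    Matrix ι ι ℂ →ₗ[ℂ] Matrix κ κ ℂ :=
  (Matrix.traceLinearMap ι ℂ ℂ).smulRight σ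

/-! ### Conditional disclosure of secrets with quantum resources -/

/-- A CDQS protocol for a one-qubit secret `Q = Fin 2` and `n`-bit inputs: a resource state on
`L ⊗ R`, Alice's channels `Q L → M_A` and Bob's channels `R → M_B`. -/
structure CDQSProtocol (n : ℕ) where
  dL : ℕ
  dR : ℕ
  dA : ℕ
  dB : ℕ
  resource : Matrix (Fin dL × Fin dR) (Fin dL × Fin dR) ℂ
  resource_isDensity : IsDensity resource
  alice : Bits n → Channel (Fin 2 × Fin dL) (Fin dA)
  bob : Bits n → Channel (Fin dR) (Fin dB)

namespace CDQSProtocol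

variable {n : ℕ}

/-- `X_Q ↦ X_Q ⊗ Ψ_{LR}`, with the systems grouped as `(Q L) R`. -/
def attach (P : CDQSProtocol n) : Matrix (Fin 2) (Fin 2) ℂ →ₗ[ℂ]
    Matrix ((Fin 2 × Fin P.dL) × Fin P.dR) ((Fin 2 × Fin P.dL) × Fin P.dR) ℂ where
  toFun X := Matrix.of fun p q => X p.1.1 q.1.1 * P.resource (p.1.2, p.2) (q.1.2, q.2)
  map_add' X Y := by
    ext p q
    simp [add_mul]
  map_smul' c X := by
    ext p q
    simp [mul_assoc]

/-- The combined action `Q → M_A M_B` of Alice and Bob, `X ↦ (N^x ⊗ N^y)(X ⊗ Ψ)`. -/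
def encode (P : CDQSProtocol n) (x y : Bits n) : Matrix (Fin 2) (Fin 2) ℂ →ₗ[ℂ]
    Matrix (Fin P.dA × Fin P.dB) (Fin P.dA × Fin P.dB) ℂ where
  toFun X := onRight (P.bob y).toLin (onLeft (P.alice x).toLin (P.attach X))
  map_add' X Y := by
    have h1 : ∀ U V, onLeft (P.alice x).toLin (U + V) =
        onLeft (γ := Fin P.dR) (P.alice x).toLin U + onLeft (P.alice x).toLin V := by
      intro U V
      ext p q
      exact congrFun₂ (map_add (P.alice x).toLin
        (Matrix.of fun i j => U (i, p.2) (j, q.2))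
        (Matrix.of fun i j => V (i, p.2) (j, q.2))) p.1 q.1
    rw [map_add, h1]
    generalize onLeft (P.alice x).toLin (P.attach X) = U
    generalize onLeft (P.alice x).toLin (P.attach Y) = V
    ext p q
    exact congrFun₂ (map_add (P.bob y).toLin
      (Matrix.of fun i j => U (p.1, i) (q.1, j))
      (Matrix.of fun i j => V (p.1, i) (q.1, j))) p.2 q.2
  map_smul' c X := by
    have h1 : ∀ U, onLeft (P.alice x).toLin (c • U) =
        c • onLeft (γ := Fin P.dR) (P.alice x).toLin U := by
      intro U
      ext p q
      exact congrFun₂ (map_smul (P.alice x).toLin c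
        (Matrix.of fun i j => U (i, p.2) (j, q.2))) p.1 q.1
    rw [map_smul, h1]
    generalize onLeft (P.alice x).toLin (P.attach X) = U
    ext p q
    exact congrFun₂ (map_smul (P.bob y).toLin c
      (Matrix.of fun i j => U (p.1, i) (q.1, j))) p.2 q.2

/-- `ε`-correctness. -/
def Correct (P : CDQSProtocol n) (f : Bits n → Bits n → Bool) (ε : ℝ) : Prop :=
  ∀ x y, f x y = true → ∃ D : Channel (Fin P.dA × Fin P.dB) (Fin 2),
    diamondDist (D.toLin ∘ₗ P.encode x y) LinearMap.id ≤ ENNReal.ofReal ε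

/-- `δ`-security. -/
def Secure (P : CDQSProtocol n) (f : Bits n → Bits n → Bool) (δ : ℝ) : Prop :=
  ∀ x y, f x y = false →
    ∃ σ : Matrix (Fin P.dA × Fin P.dB) (Fin P.dA × Fin P.dB) ℂ, IsDensity σ ∧
      diamondDist (discardPrepare σ) (P.encode x y) ≤ ENNReal.ofReal δ

/-- Number of qubits of shared resource plus number of qubits of message. -/
def totalCost (P : CDQSProtocol n) : ℝ :=
  (Real.logb 2 P.dL + Real.logb 2 P.dR) + (Real.logb 2 P.dA + Real.logb 2 P.dB)

end CDQSProtocol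

/-- The entanglement-plus-communication cost `CDQS‾_{ε,δ}(f)`. -/
def cdqsBar {n : ℕ} (ε δ : ℝ) (f : Bits n → Bits n → Bool) : ℝ≥0∞ :=
  ⨅ (P : CDQSProtocol n) (_ : P.Correct f ε) (_ : P.Secure f δ), ENNReal.ofReal P.totalCost

/-! ### Two-prover, two-message, public-coin quantum proofs -/

/-- The interaction of two verifiers whose workspaces have dimensions `a` (Alice) and `b` (Bob).
Alice's operations may depend on her input and on the public coins, Bob's on his input.
Each step is one message, of dimension `c`, together with the local operations of its sender and
its receiver; at the end Alice applies the measurement `{E, 1 - E}`, and `E` means accept. -/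
inductive Interaction (n k : ℕ) : ℕ → ℕ → Type
  | output {a b : ℕ} (E : Bits n → Bits k → Matrix (Fin a) (Fin a) ℂ)
      (E_nonneg : ∀ x r, (E x r).PosSemidef) (E_le_one : ∀ x r, (1 - E x r).PosSemidef) :
      Interaction n k a b
  | aliceSends {a b : ℕ} (a' b' c : ℕ)
      (send : Bits n → Bits k → Channel (Fin a) (Fin a' × Fin c))
      (receive : Bits n → Channel (Fin c × Fin b) (Fin b'))
      (next : Interaction n k a' b') : Interaction n k a b
  | bobSends {a b : ℕ} (a' b' c : ℕ)
      (send : Bits n → Channel (Fin b) (Fin c × Fin b'))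
      (receive : Bits n → Bits k → Channel (Fin a × Fin c) (Fin a'))
      (next : Interaction n k a' b') : Interaction n k a b

namespace Interaction

variable {n k : ℕ}

/-- Number of qubits exchanged by Alice and Bob. -/
def cost : {a b : ℕ} → Interaction n k a b → ℝ
  | _, _, output _ _ _ => 0
  | _, _, aliceSends _ _ c _ _ next => Real.logb 2 c + next.cost
  | _, _, bobSends _ _ c _ _ next => Real.logb 2 c + next.cost

/-- Probability that Alice accepts, on inputs `x`, `y` and coins `r`, when the joint workspace of
Alice and Bob is in the state `ρ`. -/
def acceptProb (x y : Bits n) (r : Bits k) : {a b : ℕ} → Interaction n k a b →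
    Matrix (Fin a × Fin b) (Fin a × Fin b) ℂ → ℝ
  | _, b, output E _ _, ρ => (((E x r) ⊗ₖ (1 : Matrix (Fin b) (Fin b) ℂ)) * ρ).trace.re
  | _, b, aliceSends a' _ c send receive next, ρ =>
      next.acceptProb x y r (onRight (receive y).toLin
        (Matrix.reindex (Equiv.prodAssoc (Fin a') (Fin c) (Fin b))
          (Equiv.prodAssoc (Fin a') (Fin c) (Fin b)) (onLeft (send x r).toLin ρ)))
  | a, _, bobSends _ b' c send receive next, ρ =>
      next.acceptProb x y r (onLeft (receive x r).toLin
        (Matrix.reindex (Equiv.prodAssoc (Fin a) (Fin c) (Fin b')).symm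
          (Equiv.prodAssoc (Fin a) (Fin c) (Fin b')).symm (onRight (send y).toLin ρ)))

end Interaction

/-- The verifiers of a two-prover, two-message, public-coin proof with `n`-bit inputs:
`k` public coins, messages `M_A`, `M_B` from prover 1 and `M_A'`, `M_B'` from prover 2, a shared
pure state of Alice and Bob on `L ⊗ R`, and the subsequent interaction of Alice and Bob. -/
structure QAMVerifiers (n : ℕ) where
  k : ℕ
  mA : ℕ
  mB : ℕ
  mA' : ℕ
  mB' : ℕ
  mA_pos : 0 < mA
  mB_pos : 0 < mB
  mA'_pos : 0 < mA'
  mB'_pos : 0 < mB'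
  dL : ℕ
  dR : ℕ
  shared : Fin dL × Fin dR → ℂ
  shared_unit : ∑ i, ‖shared i‖ ^ 2 = 1
  a : ℕ
  b : ℕ
  aliceInit : Bits n → Bits k → Channel ((Fin mA × Fin mA') × Fin dL) (Fin a)
  bobInit : Bits n → Channel ((Fin mB × Fin mB') × Fin dR) (Fin b)
  interaction : Interaction n k a b

/-- A strategy of the two provers for one pair of inputs: a shared state on `P ⊗ P'`, operations of
prover 1 on `P`, which may depend on the public coins, and an operation of prover 2 on `P'`, which
may not. -/
structure ProverStrategy (k mA mB mA' mB' : ℕ) where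
  p : ℕ
  p' : ℕ
  state : Matrix (Fin p × Fin p') (Fin p × Fin p') ℂ
  state_isDensity : IsDensity state
  prover1 : Bits k → Channel (Fin p) (Fin mA × Fin mB)
  prover2 : Channel (Fin p') (Fin mA' × Fin mB')

namespace QAMVerifiers

variable {n : ℕ}

/-- Strategies of the provers against the given verifiers. -/
abbrev Strategy (V : QAMVerifiers n) : Type := ProverStrategy V.k V.mA V.mB V.mA' V.mB'

/-- The state on `(M_A M_B)(M_A' M_B')` sent by the provers on coins `r`. -/
def proverState (V : QAMVerifiers n) (S : V.Strategy) (r : Bits V.k) :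
    Matrix ((Fin V.mA × Fin V.mB) × (Fin V.mA' × Fin V.mB'))
      ((Fin V.mA × Fin V.mB) × (Fin V.mA' × Fin V.mB')) ℂ :=
  onRight S.prover2.toLin (onLeft (S.prover1 r).toLin S.state)

/-- The state of all systems after the provers' messages, grouped as Alice's systems
`(M_A M_A') L` and Bob's systems `(M_B M_B') R`. -/
def jointState (V : QAMVerifiers n) (S : V.Strategy) (r : Bits V.k) :
    Matrix (((Fin V.mA × Fin V.mA') × Fin V.dL) × ((Fin V.mB × Fin V.mB') × Fin V.dR))
      (((Fin V.mA × Fin V.mA') × Fin V.dL) × ((Fin V.mB × Fin V.mB') × Fin V.dR)) ℂ :=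
  Matrix.of fun p q =>
    V.proverState S r ((p.1.1.1, p.2.1.1), (p.1.1.2, p.2.1.2))
        ((q.1.1.1, q.2.1.1), (q.1.1.2, q.2.1.2)) *
      (V.shared (p.1.2, p.2.2) * star (V.shared (q.1.2, q.2.2)))

/-- Probability that Alice accepts, averaged over the uniformly random coins. -/
def acceptProb (V : QAMVerifiers n) (S : V.Strategy) (x y : Bits n) : ℝ :=
  (∑ r : Bits V.k, V.interaction.acceptProb x y r
    (onRight (V.bobInit y).toLin (onLeft (V.aliceInit x r).toLin (V.jointState S r)))) / 2 ^ V.k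

/-- `ε`-correctness: on 1-inputs some strategy is accepted with probability at least `1 - ε`. -/
def Correct (V : QAMVerifiers n) (f : Bits n → Bits n → Bool) (ε : ℝ) : Prop :=
  ∀ x y, f x y = true → ∃ S : V.Strategy, 1 - ε ≤ V.acceptProb S x y

/-- `δ`-security: on 0-inputs every strategy is accepted with probability at most `δ`. -/
def Secure (V : QAMVerifiers n) (f : Bits n → Bits n → Bool) (δ : ℝ) : Prop :=
  ∀ x y, f x y = false → ∀ S : V.Strategy, V.acceptProb S x y ≤ δ

/-- Number of qubits sent by the provers plus number of qubits exchanged by the verifiers. -/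
def cost (V : QAMVerifiers n) : ℝ :=
  (Real.logb 2 V.mA + Real.logb 2 V.mB + Real.logb 2 V.mA' + Real.logb 2 V.mB') +
    V.interaction.cost

end QAMVerifiers

/-- The cost `QAM[2,2]^cc_{ε,δ}(f)`. -/
def qam22 {n : ℕ} (ε δ : ℝ) (f : Bits n → Bits n → Bool) : ℝ≥0∞ :=
  ⨅ (V : QAMVerifiers n) (_ : V.Correct f ε) (_ : V.Secure f δ), ENNReal.ofReal V.cost

end QuantumCDS

end

/-! Purify the CDQS protocol. For a basis secret `q` the result is a unit vector φ_q on M ⊗ E, where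
M holds the messages and E the environments of both parties together with a purification of the
resource; below it is a matrix A_q from E to M. Prover 1 is asked for M and prover 2 for E. A public
coin b, seen by prover 1 only, selects which φ_b the verifiers project onto.

On a 1-input the secret can be decoded from M. The dual of the decoder applied to the bit flip is
then an operation on M that nearly carries φ_0 to φ_1, so provers sharing φ_0 can answer either coin
(`exists_flip_of_correct`). On a 0-input M hardly depends on the secret, even for superpositions, so
the image A_1 A_0ᴴ of |1⟩⟨0| has nuclear norm at most F = 2δ (`nucBound_pureOutput_of_secure`). This
norm is the fidelity of the two states on E: the system of prover 2, who ignores b, nearly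
determines which φ_b can be reached. A Schur-test argument (`sum_norm_overlap_sq_le`) bounds the
success probability on one copy by (1 + F)/2.

For ε = δ = 0.09 the honest probability, at least (1 + 0.91²)/2, exceeds 3/4, and the cheating bound
0.59 lies below it. Arbitrary constant errors are reached with 4L copies and acceptance when at
least 3L tests succeed. Entangled cheating across copies is handled because the Gram bounds
tensorise: the tests in a set S all succeed with probability at most ((1 + F)/2)^|S|
(`sum_quadForm_subset_le`). An exponential-moment bound with weight 3 per success
(`sum_threshold_le`), or per failure for completeness (`sum_not_threshold_le`), then gives
exponential decay in L.

The verifiers can carry out the projection cheaply. Bob undoes the Stinespring isometry of his CDQS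
channel on his share and sends the outcome to Alice, and the vector she must then test depends on x
only (`pureOutput_eq_sum`). Since minimal Kraus families keep the environments as small as the
protocol itself, the cost is linear in the cost of the protocol (`toVerifiers_cost_le`). -/

noncomputable section

namespace QuantumCDS

/-! ### Hilbert–Schmidt norm -/

section HilbertSchmidt

variable {m n p : Type} [Fintype m] [Fintype n] [Fintype p]

/-- The square of the Hilbert–Schmidt norm. -/
def hsSq (X : Matrix m n ℂ) : ℝ := ∑ i, ∑ j, ‖X i j‖ ^ 2

lemma hsSq_nonneg (X : Matrix m n ℂ) : 0 ≤ hsSq X :=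
  Finset.sum_nonneg fun _ _ => Finset.sum_nonneg fun _ _ => by positivity

lemma trace_conjTranspose_mul_eq_sum (X Y : Matrix m n ℂ) :
    (Xᴴ * Y).trace = ∑ i, ∑ j, star (X i j) * Y i j := by
  simp only [Matrix.trace, Matrix.diag_apply, Matrix.mul_apply, Matrix.conjTranspose_apply]
  exact Finset.sum_comm

lemma trace_conjTranspose_mul_self (X : Matrix m n ℂ) : (Xᴴ * X).trace = (hsSq X : ℂ) := by
  rw [trace_conjTranspose_mul_eq_sum, hsSq]
  push_cast
  refine Finset.sum_congr rfl fun i _ => Finset.sum_congr rfl fun j _ => ?_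
  simpa using Complex.conj_mul' (X i j)

lemma hsSq_eq_of_gram_eq {X : Matrix m n ℂ} {Y : Matrix p n ℂ} (h : Xᴴ * X = Yᴴ * Y) :
    hsSq X = hsSq Y := by
  have := congrArg Matrix.trace h
  rw [trace_conjTranspose_mul_self, trace_conjTranspose_mul_self] at this
  exact_mod_cast this

lemma norm_trace_conjTranspose_mul_sq_le (X Y : Matrix m n ℂ) :
    ‖(Xᴴ * Y).trace‖ ^ 2 ≤ hsSq X * hsSq Y := by
  rw [trace_conjTranspose_mul_eq_sum]
  simp only [hsSq, ← Fintype.sum_prod_type' (f := fun i j => star (X i j) * Y i j),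
    ← Fintype.sum_prod_type' (f := fun i j => ‖X i j‖ ^ 2),
    ← Fintype.sum_prod_type' (f := fun i j => ‖Y i j‖ ^ 2)]
  calc ‖∑ x : m × n, star (X x.1 x.2) * Y x.1 x.2‖ ^ 2
      ≤ (∑ x : m × n, ‖X x.1 x.2‖ * ‖Y x.1 x.2‖) ^ 2 := by
        gcongr
        refine (norm_sum_le _ _).trans (le_of_eq ?_)
        simp
    _ ≤ _ := Finset.sum_mul_sq_le_sq_mul_sq _ _ _

lemma norm_trace_conjTranspose_mul_le {X Y : Matrix m n ℂ} {a b : ℝ} (ha : 0 ≤ a) (hb : 0 ≤ b)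
    (hX : hsSq X ≤ a ^ 2) (hY : hsSq Y ≤ b ^ 2) : ‖(Xᴴ * Y).trace‖ ≤ a * b := by
  refine abs_le_of_sq_le_sq' ?_ (by positivity) |>.2
  calc _ ≤ hsSq X * hsSq Y := norm_trace_conjTranspose_mul_sq_le X Y
    _ ≤ a ^ 2 * b ^ 2 := mul_le_mul hX hY (hsSq_nonneg _) (by positivity)
    _ = _ := by ring

lemma hsSq_isometry_mul [DecidableEq n] {V : Matrix m n ℂ} (hV : Vᴴ * V = 1)
    (X : Matrix n p ℂ) : hsSq (V * X) = hsSq X := by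
  apply hsSq_eq_of_gram_eq
  rw [Matrix.conjTranspose_mul, Matrix.mul_assoc, ← Matrix.mul_assoc Vᴴ, hV, Matrix.one_mul]

/-- ‖VᴴX‖² = ⟨X, VVᴴX⟩ ≤ ‖X‖ ‖VVᴴX‖ = ‖X‖ ‖VᴴX‖ by Cauchy–Schwarz and isometry of V; one factor
cancels. -/
lemma hsSq_conjTranspose_isometry_mul_le [DecidableEq n] {V : Matrix m n ℂ} (hV : Vᴴ * V = 1)
    (X : Matrix m p ℂ) : hsSq (Vᴴ * X) ≤ hsSq X := by
  have h1 : (hsSq (Vᴴ * X) : ℂ) = (Xᴴ * (V * (Vᴴ * X))).trace := by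
    rw [← trace_conjTranspose_mul_self, Matrix.conjTranspose_mul,
      Matrix.conjTranspose_conjTranspose, Matrix.mul_assoc]
  have h2 := norm_trace_conjTranspose_mul_sq_le X (V * (Vᴴ * X))
  rw [← h1, hsSq_isometry_mul hV, Complex.norm_real, Real.norm_eq_abs, sq_abs, sq] at h2
  rcases (hsSq_nonneg (Vᴴ * X)).eq_or_lt with h | h
  · rw [← h]; exact hsSq_nonneg X
  · exact le_of_mul_le_mul_right h2 h

lemma hsSq_smul (c : ℂ) (X : Matrix m n ℂ) : hsSq (c • X) = ‖c‖ ^ 2 * hsSq X := by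
  simp [hsSq, Finset.mul_sum, mul_pow]

lemma hsSq_submatrix_le {m' : Type} [Fintype m'] (X : Matrix m n ℂ)
    {e : m' → m} (he : e.Injective) : hsSq (X.submatrix e id) ≤ hsSq X := by
  classical
  simp only [hsSq, Matrix.submatrix_apply, id]
  rw [← Finset.sum_image (s := Finset.univ) (g := e) (f := fun i => ∑ j, ‖X i j‖ ^ 2)
    (fun a _ b _ h => he h)]
  exact Finset.sum_le_sum_of_subset_of_nonneg (Finset.subset_univ _)
    fun _ _ _ => Finset.sum_nonneg fun _ _ => by positivity

end HilbertSchmidt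

open scoped MatrixOrder in
lemma exists_eq_conjTranspose_mul_self {n : Type} [Fintype n] {M : Matrix n n ℂ}
    (h : M.PosSemidef) : ∃ C : Matrix n n ℂ, M = Cᴴ * C := by
  classical
  exact CStarAlgebra.nonneg_iff_eq_star_mul_self.mp h.nonneg

lemma exists_eq_mul_conjTranspose {n : Type} [Fintype n] {M : Matrix n n ℂ}
    (h : M.PosSemidef) : ∃ C : Matrix n n ℂ, M = C * Cᴴ := by
  obtain ⟨C, hC⟩ := exists_eq_conjTranspose_mul_self h
  exact ⟨Cᴴ, by rw [Matrix.conjTranspose_conjTranspose, hC]⟩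

/-! ### Tensor powers of matrices -/

section PiMat

variable {ι α β γ : Type} [Fintype ι]

/-- The tensor product of a family of matrices. -/
def piMat (M : ι → Matrix α β ℂ) : Matrix (ι → α) (ι → β) ℂ :=
  Matrix.of fun f g => ∏ i, M i (f i) (g i)

lemma piMat_apply (M : ι → Matrix α β ℂ) (f g) : piMat M f g = ∏ i, M i (f i) (g i) := rfl

lemma piMat_mul [DecidableEq ι] [Fintype β] (M : ι → Matrix α β ℂ) (N : ι → Matrix β γ ℂ) :
    piMat M * piMat N = piMat fun i => M i * N i := by
  ext f g
  simp only [Matrix.mul_apply, piMat_apply, ← Finset.prod_mul_distrib]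
  rw [Finset.prod_univ_sum, Fintype.piFinset_univ]

lemma piMat_conjTranspose (M : ι → Matrix α β ℂ) : (piMat M)ᴴ = piMat fun i => (M i)ᴴ := by
  ext f g
  simp [piMat_apply, Matrix.conjTranspose_apply]

lemma piMat_one [DecidableEq ι] [DecidableEq α] : piMat (fun _ : ι => (1 : Matrix α α ℂ)) = 1 := by
  ext f g
  simp only [piMat_apply, Matrix.one_apply, Finset.prod_ite_zero, Finset.prod_const_one,
    Finset.mem_univ, true_implies, funext_iff]

lemma piMat_trace [DecidableEq ι] [Fintype α] (M : ι → Matrix α α ℂ) :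
    (piMat M).trace = ∏ i, (M i).trace := by
  simp only [Matrix.trace, Matrix.diag_apply, piMat_apply]
  rw [Finset.prod_univ_sum, Fintype.piFinset_univ]

lemma piMat_posSemidef [DecidableEq ι] [Fintype α] {M : ι → Matrix α α ℂ}
    (h : ∀ i, (M i).PosSemidef) : (piMat M).PosSemidef := by
  classical
  choose C hC using fun i => exists_eq_conjTranspose_mul_self (h i)
  have : piMat M = (piMat C)ᴴ * piMat C := by
    rw [piMat_conjTranspose, piMat_mul]; congr 1; exact funext hC
  rw [this]
  exact Matrix.posSemidef_conjTranspose_mul_self _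

/-- Multilinear expansion of a tensor power. It resolves the identity into joint test outcomes and
later serves as a generating function for the number of successes. -/
lemma piMat_add [DecidableEq ι] (M N : ι → Matrix α β ℂ) :
    piMat (fun i => M i + N i) = ∑ S : Finset ι, piMat fun i => if i ∈ S then M i else N i := by
  ext f g
  rw [Matrix.sum_apply]
  simp only [piMat_apply, Matrix.add_apply, Finset.prod_add, Finset.powerset_univ]
  refine Finset.sum_congr rfl fun S _ => ?_
  rw [← Finset.prod_mul_prod_compl S, Finset.compl_eq_univ_sdiff]
  congr 1
  · exact Finset.prod_congr rfl fun i hi => by rw [if_pos hi]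
  · exact Finset.prod_congr rfl fun i hi => by rw [if_neg (by simpa using hi)]

lemma hsSq_piMat [DecidableEq ι] [Fintype α] [Fintype β] (M : ι → Matrix α β ℂ) :
    hsSq (piMat M) = ∏ i, hsSq (M i) := by
  have h : ((hsSq (piMat M) : ℝ) : ℂ) = ((∏ i, hsSq (M i) : ℝ) : ℂ) := by
    rw [← trace_conjTranspose_mul_self, piMat_conjTranspose, piMat_mul, piMat_trace]
    push_cast
    exact Finset.prod_congr rfl fun i _ => trace_conjTranspose_mul_self _
  exact_mod_cast h

end PiMat

/-! ### Bounds on the nuclear norm -/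

section NucBound

variable {m n : Type} [Fintype m] [Fintype n]

/-- `B` has nuclear norm at most `q`, witnessed by a factorisation `B = X Yᴴ` through
Hilbert–Schmidt matrices. -/
def NucBound (B : Matrix m n ℂ) (q : ℝ) : Prop :=
  ∃ (J : Type) (_ : Fintype J) (X : Matrix m J ℂ) (Y : Matrix n J ℂ),
    B = X * Yᴴ ∧ hsSq X ≤ q ∧ hsSq Y ≤ q

lemma NucBound.nonneg {B : Matrix m n ℂ} {q : ℝ} (h : NucBound B q) : 0 ≤ q := by
  obtain ⟨J, _, X, Y, -, hX, -⟩ := h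
  exact (hsSq_nonneg X).trans hX

lemma NucBound.mono {B : Matrix m n ℂ} {q q' : ℝ} (h : NucBound B q) (hq : q ≤ q') :
    NucBound B q' := by
  obtain ⟨J, _, X, Y, hB, hX, hY⟩ := h
  exact ⟨J, _, X, Y, hB, hX.trans hq, hY.trans hq⟩

lemma NucBound.conjTranspose {B : Matrix m n ℂ} {q : ℝ} (h : NucBound B q) : NucBound Bᴴ q := by
  obtain ⟨J, _, X, Y, rfl, hX, hY⟩ := h
  exact ⟨J, _, Y, X, by simp, hY, hX⟩

lemma NucBound.smul {B : Matrix m n ℂ} {q : ℝ} (h : NucBound B q) (c : ℂ) :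
    NucBound (c • B) (‖c‖ * q) := by
  obtain ⟨J, _, X, Y, rfl, hX, hY⟩ := h
  have h1 : ‖(Real.sqrt ‖c‖ : ℂ)‖ ^ 2 = ‖c‖ := by
    rw [Complex.norm_real, Real.norm_eq_abs, sq_abs, Real.sq_sqrt (norm_nonneg c)]
  -- The modulus of `c` is shared equally by the two factors and its phase goes to the first. For `c
  -- = 0` the quotient is 0, which is what is needed.
  refine ⟨J, inferInstance, (c / (Real.sqrt ‖c‖ : ℂ)) • X, (Real.sqrt ‖c‖ : ℂ) • Y, ?_, ?_, ?_⟩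
  · rw [Matrix.conjTranspose_smul, Matrix.smul_mul, Matrix.mul_smul, smul_smul]
    congr 1
    simp only [RCLike.star_def, Complex.conj_ofReal]
    rcases eq_or_ne c 0 with rfl | hc
    · simp
    · rw [div_mul_cancel₀]
      simpa [Real.sqrt_eq_zero'] using hc
  · rw [hsSq_smul, norm_div, div_pow, h1]
    rcases eq_or_ne c 0 with rfl | hc
    · simp
    · rw [sq, mul_div_assoc, div_self (norm_ne_zero_iff.2 hc), mul_one]
      gcongr
  · rw [hsSq_smul, h1]
    gcongr

/-- Writing the two factorisations side by side gives the triangle inequality, with no appeal to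
duality of norms. -/
lemma NucBound.add {B C : Matrix m n ℂ} {q r : ℝ} (hB : NucBound B q) (hC : NucBound C r) :
    NucBound (B + C) (q + r) := by
  obtain ⟨J, _, X, Y, rfl, hX, hY⟩ := hB
  obtain ⟨J', _, X', Y', rfl, hX', hY'⟩ := hC
  refine ⟨J ⊕ J', inferInstance, Matrix.fromCols X X', Matrix.fromCols Y Y', ?_, ?_, ?_⟩
  · rw [Matrix.conjTranspose_fromCols_eq_fromRows_conjTranspose, Matrix.fromCols_mul_fromRows]
  · simp only [hsSq, Fintype.sum_sum_type, Matrix.fromCols_apply_inl, Matrix.fromCols_apply_inr,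
      Finset.sum_add_distrib] at *
    gcongr
  · simp only [hsSq, Fintype.sum_sum_type, Matrix.fromCols_apply_inl, Matrix.fromCols_apply_inr,
      Finset.sum_add_distrib] at *
    gcongr

lemma NucBound.submatrix {m' n' : Type} [Fintype m'] [Fintype n'] {B : Matrix m n ℂ} {q : ℝ}
    (h : NucBound B q) {e : m' → m} {e' : n' → n} (he : e.Injective) (he' : e'.Injective) :
    NucBound (B.submatrix e e') q := by
  obtain ⟨J, _, X, Y, rfl, hX, hY⟩ := h
  exact ⟨J, _, X.submatrix e id, Y.submatrix e' id, by ext; rfl,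
    (hsSq_submatrix_le X he).trans hX, (hsSq_submatrix_le Y he').trans hY⟩

/-- Factorisations tensorise, and the Hilbert–Schmidt norm is multiplicative. The inner index types
may differ from factor to factor, so the witnesses are dependent products and not instances of
`piMat`. -/
lemma NucBound.piMat {ι : Type} [Fintype ι] [DecidableEq ι] {B : ι → Matrix m n ℂ} {q : ι → ℝ}
    (h : ∀ i, NucBound (B i) (q i)) : NucBound (QuantumCDS.piMat B) (∏ i, q i) := by
  choose J hJ X Y hB hX hY using h
  refine ⟨∀ i, J i, inferInstance, Matrix.of fun f g => ∏ i, X i (f i) (g i),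
    Matrix.of fun f g => ∏ i, Y i (f i) (g i), ?_, ?_, ?_⟩
  · ext f g
    simp only [piMat_apply, Matrix.mul_apply, Matrix.conjTranspose_apply, Matrix.of_apply, hB,
      star_prod, ← Finset.prod_mul_distrib]
    rw [Finset.prod_univ_sum, Fintype.piFinset_univ]
  · refine le_trans (le_of_eq ?_) (Finset.prod_le_prod (fun i _ => hsSq_nonneg (X i))
      fun i _ => hX i)
    simp only [hsSq, Matrix.of_apply, norm_prod, ← Finset.prod_pow]
    simp only [Finset.prod_univ_sum, Fintype.piFinset_univ]
  · refine le_trans (le_of_eq ?_) (Finset.prod_le_prod (fun i _ => hsSq_nonneg (Y i))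
      fun i _ => hY i)
    simp only [hsSq, Matrix.of_apply, norm_prod, ← Finset.prod_pow]
    simp only [Finset.prod_univ_sum, Fintype.piFinset_univ]

lemma nucBound_mul_conjTranspose {J : Type} [Fintype J] (X : Matrix m J ℂ) (Y : Matrix n J ℂ)
    {q : ℝ} (hX : hsSq X ≤ q) (hY : hsSq Y ≤ q) : NucBound (X * Yᴴ) q :=
  ⟨J, _, X, Y, rfl, hX, hY⟩

/-- Singular value decomposition: with U diagonalising BᴴB and D the singular values, B = (B U
D^(-1/2)) (U D^(1/2))ᴴ, and both factors have squared Hilbert–Schmidt norm tr D. -/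
lemma nucBound_traceNorm [DecidableEq m] (B : Matrix m m ℂ) : NucBound B (traceNorm B) := by
  set hH := Matrix.isHermitian_conjTranspose_mul_self B
  set ev := hH.eigenvalues with hev
  set U : Matrix m m ℂ := (hH.eigenvectorUnitary : Matrix m m ℂ) with hU
  have hUU : U * Uᴴ = 1 := Unitary.coe_mul_star_self hH.eigenvectorUnitary
  have hUU' : Uᴴ * U = 1 := Unitary.coe_star_mul_self hH.eigenvectorUnitary
  have hnn : ∀ i, 0 ≤ ev i := (Matrix.posSemidef_conjTranspose_mul_self B).eigenvalues_nonneg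
  set s : m → ℝ := fun i => Real.sqrt (Real.sqrt (ev i)) with hs
  have hss : ∀ i, s i ^ 2 = Real.sqrt (ev i) := fun i => Real.sq_sqrt (Real.sqrt_nonneg _)
  have hdiag : (B * U)ᴴ * (B * U) = Matrix.diagonal fun i => (ev i : ℂ) := by
    have := hH.spectral_theorem
    rw [Unitary.conjStarAlgAut_apply] at this
    rw [Matrix.conjTranspose_mul, Matrix.mul_assoc, ← Matrix.mul_assoc Bᴴ, this]
    change Uᴴ * (U * Matrix.diagonal _ * Uᴴ * U) = _
    rw [Matrix.mul_assoc _ Uᴴ U, hUU', Matrix.mul_one, ← Matrix.mul_assoc, hUU', Matrix.one_mul]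
    rfl
  have hcol : ∀ i, ∑ k, ‖(B * U) k i‖ ^ 2 = ev i := by
    intro i
    have := congrFun₂ hdiag i i
    rw [Matrix.mul_apply, Matrix.diagonal_apply_eq] at this
    have h2 : ((∑ k, ‖(B * U) k i‖ ^ 2 : ℝ) : ℂ) = ev i := by
      rw [← this]; push_cast
      refine Finset.sum_congr rfl fun k _ => ?_
      rw [Matrix.conjTranspose_apply]
      simpa using (Complex.conj_mul' ((B * U) k i)).symm
    exact_mod_cast h2
  refine ⟨m, inferInstance, B * U * Matrix.diagonal fun i => ((s i)⁻¹ : ℂ),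
    U * Matrix.diagonal fun i => (s i : ℂ), ?_, ?_, ?_⟩
  · have h1 : B * U * Matrix.diagonal (fun i => ((s i)⁻¹ : ℂ)) *
        (Matrix.diagonal fun i => (s i : ℂ)) = B * U := by
      ext k i
      rw [Matrix.mul_diagonal, Matrix.mul_diagonal]
      -- A vanishing singular value has inverse 0 by convention; this is harmless because the
      -- corresponding column of `B * U` is zero.
      by_cases h0 : s i = 0
      · have : ev i = 0 := by
          have := hss i
          rw [h0] at this
          have h3 := Real.sqrt_eq_zero (hnn i) |>.1 (by rw [← this]; norm_num)
          exact h3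
        have h4 := hcol i
        rw [this, Finset.sum_eq_zero_iff_of_nonneg (fun _ _ => by positivity)] at h4
        have h5 := h4 k (Finset.mem_univ _)
        have h6 : (B * U) k i = 0 := by simpa using h5
        rw [h6]; simp
      · have : (s i : ℂ) ≠ 0 := by exact_mod_cast h0
        field_simp
    rw [Matrix.conjTranspose_mul, Matrix.diagonal_conjTranspose]
    have h2 : star (fun i => (s i : ℂ)) = fun i => (s i : ℂ) := by
      ext i; simp
    rw [h2, ← Matrix.mul_assoc, h1, Matrix.mul_assoc, hUU, Matrix.mul_one]
  · apply le_of_eq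
    rw [hsSq, Finset.sum_comm, traceNorm]
    refine Finset.sum_congr rfl fun i _ => ?_
    simp only [Matrix.mul_diagonal, norm_mul, mul_pow]
    rw [← Finset.sum_mul, hcol, norm_inv, Complex.norm_real, Real.norm_eq_abs, inv_pow, sq_abs,
      hss, ← div_eq_mul_inv, Real.div_sqrt]
  · apply le_of_eq
    rw [hsSq_isometry_mul hUU', hsSq, Finset.sum_comm, traceNorm]
    refine Finset.sum_congr rfl fun i _ => ?_
    rw [Finset.sum_eq_single i]
    · rw [Matrix.diagonal_apply_eq, Complex.norm_real, Real.norm_eq_abs, sq_abs, hss]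
    · intro j _ hj; simp [Matrix.diagonal_apply_ne _ hj]
    · simp

end NucBound

end QuantumCDS

end

noncomputable section

namespace QuantumCDS

/-! ### Overlaps of several vectors with states that agree outside one factor -/

section Overlap

variable {M E P J : Type} [Fintype M] [Fintype E] [Fintype P] [Fintype J]

lemma sum_conjTranspose_mul_self_eq_stack {M P J : Type} [Fintype M] [Fintype J]
    (N : J → Matrix M P ℂ) :
    (Matrix.of fun (i : J × M) p => N i.1 i.2 p)ᴴ * (Matrix.of fun (i : J × M) p => N i.1 i.2 p) =
      ∑ j, (N j)ᴴ * N j := by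
  ext p q
  simp only [Matrix.mul_apply, Matrix.sum_apply, Matrix.conjTranspose_apply, Matrix.of_apply,
    Fintype.sum_prod_type]

/-- The combination equals Vᴴ(z ⊗ 1), with V the isometry that stacks the Kraus operators, so its
operator norm is at most that of the vector z. -/
lemma hsSq_sum_smul_kraus_mul_le [DecidableEq P] {N : J → Matrix M P ℂ}
    (hN : ∑ j, (N j)ᴴ * N j = 1) (z : J → ℂ) (X : Matrix M E ℂ) :
    hsSq ((∑ j, z j • (N j)ᴴ) * X) ≤ (∑ j, ‖z j‖ ^ 2) * hsSq X := by
  set V : Matrix (J × M) P ℂ := Matrix.of fun i p => N i.1 i.2 p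
  have hV : Vᴴ * V = 1 := by rw [← hN]; exact sum_conjTranspose_mul_self_eq_stack N
  have h := hsSq_conjTranspose_isometry_mul_le hV
    (Matrix.of fun (i : J × M) k => z i.1 * X i.2 k)
  have h1 : Vᴴ * (Matrix.of fun (i : J × M) k => z i.1 * X i.2 k) = (∑ j, z j • (N j)ᴴ) * X := by
    rw [Matrix.sum_mul]
    ext p k
    simp only [V, Matrix.mul_apply, Matrix.sum_apply, Matrix.conjTranspose_apply, Matrix.of_apply,
      Fintype.sum_prod_type, Matrix.smul_apply, smul_eq_mul]
    exact Finset.sum_congr rfl fun _ _ => Finset.sum_congr rfl fun _ _ => by ring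
  rw [h1] at h
  refine h.trans (le_of_eq ?_)
  simp only [hsSq, Fintype.sum_prod_type, Matrix.of_apply, norm_mul, mul_pow, ← Finset.mul_sum,
    Finset.sum_mul]

lemma sum_hsSq_kraus_mul [DecidableEq P] {N : J → Matrix M P ℂ}
    (hN : ∑ j, (N j)ᴴ * N j = 1) (X : Matrix P E ℂ) : ∑ j, hsSq (N j * X) = hsSq X := by
  have h : ((∑ j, hsSq (N j * X) : ℝ) : ℂ) = hsSq X := by
    push_cast
    have h2 : ∀ j, (N j * X)ᴴ * (N j * X) = Xᴴ * ((N j)ᴴ * N j) * X := fun j => by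
      rw [Matrix.conjTranspose_mul]; simp only [Matrix.mul_assoc]
    simp only [← trace_conjTranspose_mul_self, h2]
    rw [← Matrix.trace_sum, ← Matrix.sum_mul, ← Matrix.mul_sum, hN, Matrix.mul_one]
  exact_mod_cast h

/-- By cyclicity the inner product depends on A and A' only through A A'ᴴ. Replacing that product by
its factorisation X Yᴴ leaves an ordinary Cauchy–Schwarz estimate. -/
lemma norm_trace_kraus_mul_le [DecidableEq P] {J' : Type} [Fintype J'] {N : J → Matrix M P ℂ}
    {N' : J' → Matrix M P ℂ} (hN : ∑ j, (N j)ᴴ * N j = 1) (hN' : ∑ j, (N' j)ᴴ * N' j = 1)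
    (z : J → ℂ) (z' : J' → ℂ) {A A' : Matrix M E ℂ} {q : ℝ} (h : NucBound (A * A'ᴴ) q) :
    ‖(((∑ j, z' j • (N' j)ᴴ) * A')ᴴ * ((∑ j, z j • (N j)ᴴ) * A)).trace‖ ≤
      Real.sqrt (∑ j, ‖z j‖ ^ 2) * Real.sqrt (∑ j, ‖z' j‖ ^ 2) * q := by
  have hq := h.nonneg
  obtain ⟨K, _, X, Y, hB, hX, hY⟩ := h
  set U := ∑ j, z j • (N j)ᴴ
  set U' := ∑ j, z' j • (N' j)ᴴ
  have h1 : ((U' * A')ᴴ * (U * A)).trace = ((U' * Y)ᴴ * (U * X)).trace := by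
    rw [Matrix.conjTranspose_mul, Matrix.conjTranspose_mul, Matrix.mul_assoc, Matrix.trace_mul_comm,
      Matrix.mul_assoc, Matrix.mul_assoc, hB, Matrix.mul_assoc Yᴴ, Matrix.trace_mul_comm Yᴴ]
    simp only [Matrix.mul_assoc]
  rw [h1]
  have hsum : ∀ {K : Type} [Fintype K] (w : K → ℂ), 0 ≤ ∑ j, ‖w j‖ ^ 2 :=
    fun w => Finset.sum_nonneg fun _ _ => by positivity
  have h2 := norm_trace_conjTranspose_mul_le (X := U' * Y) (Y := U * X)
    (a := Real.sqrt (∑ j, ‖z' j‖ ^ 2) * Real.sqrt q) (b := Real.sqrt (∑ j, ‖z j‖ ^ 2) * Real.sqrt q)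
    (by positivity) (by positivity)
    (by
      rw [mul_pow, Real.sq_sqrt (hsum z'), Real.sq_sqrt hq]
      exact (hsSq_sum_smul_kraus_mul_le hN' z' Y).trans (mul_le_mul_of_nonneg_left hY (hsum z')))
    (by
      rw [mul_pow, Real.sq_sqrt (hsum z), Real.sq_sqrt hq]
      exact (hsSq_sum_smul_kraus_mul_le hN z X).trans (mul_le_mul_of_nonneg_left hX (hsum z)))
  refine h2.trans (le_of_eq ?_)
  have := Real.mul_self_sqrt hq
  linear_combination (Real.sqrt (∑ j, ‖z j‖ ^ 2) * Real.sqrt (∑ j, ‖z' j‖ ^ 2)) * this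

/-- Vectors whose reduced states on `E` have small pairwise fidelities cannot all have a large
overlap with states obtained from one vector `ω` by channels acting outside `E`. -/
theorem sum_norm_overlap_sq_le {R : Type} [Fintype R] [Nonempty R] [DecidableEq P] {J : R → Type}
    [∀ r, Fintype (J r)] (A : R → Matrix M E ℂ) (g : R → R → ℝ)
    (hg : ∀ r r', NucBound (A r * (A r')ᴴ) (g r r')) (hsymm : ∀ r r', g r r' = g r' r)
    {Λ : ℝ} (hΛ : ∀ r, ∑ r', g r r' ≤ Λ)
    (N : ∀ r, J r → Matrix M P ℂ) (hN : ∀ r, ∑ j, (N r j)ᴴ * N r j = 1) (ω : Matrix P E ℂ) :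
    ∑ r, ∑ j, ‖((A r)ᴴ * (N r j * ω)).trace‖ ^ 2 ≤ Λ * hsSq ω := by
  set z : ∀ r, J r → ℂ := fun r j => ((A r)ᴴ * (N r j * ω)).trace with hz
  set t : R → ℝ := fun r => ∑ j, ‖z r j‖ ^ 2 with ht
  have ht0 : ∀ r, 0 ≤ t r := fun r => Finset.sum_nonneg fun _ _ => by positivity
  set T := ∑ r, t r with hT
  change T ≤ _
  -- Weighting the pulled-back targets by their own amplitudes turns the total success `T` into a
  -- single inner product of `∑ r, W r` with `ω`.
  set W : R → Matrix P E ℂ := fun r => (∑ j, z r j • (N r j)ᴴ) * A r with hW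
  have hTW : (T : ℂ) = ((∑ r, W r)ᴴ * ω).trace := by
    rw [Matrix.conjTranspose_sum, Matrix.sum_mul, Matrix.trace_sum, hT]
    push_cast
    refine Finset.sum_congr rfl fun r _ => ?_
    simp only [hW, ht, Matrix.sum_mul, Matrix.conjTranspose_sum, Matrix.trace_sum,
      Complex.ofReal_sum]
    refine Finset.sum_congr rfl fun j _ => ?_
    rw [Matrix.smul_mul, Matrix.conjTranspose_smul, Matrix.conjTranspose_mul,
      Matrix.conjTranspose_conjTranspose, Matrix.smul_mul, Matrix.trace_smul, Matrix.mul_assoc]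
    change _ = star (z r j) * z r j
    push_cast
    simpa using (Complex.conj_mul' (z r j)).symm
  -- Schur test: |⟨W r', W r⟩| ≤ √(t r t r') g r r', the geometric mean is at most the arithmetic
  -- mean, and symmetry reduces the double sum to row sums of `g`. Cauchy–Schwarz against `ω` then
  -- gives T² ≤ Λ T ‖ω‖².
  have hWW : hsSq (∑ r, W r) ≤ Λ * T := by
    have h1 : (hsSq (∑ r, W r) : ℂ) = ∑ r', ∑ r, ((W r')ᴴ * W r).trace := by
      rw [← trace_conjTranspose_mul_self, Matrix.conjTranspose_sum, Matrix.sum_mul,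
        Matrix.trace_sum]
      refine Finset.sum_congr rfl fun r' _ => ?_
      rw [Matrix.mul_sum, Matrix.trace_sum]
    have h2 : hsSq (∑ r, W r) ≤ ∑ r', ∑ r, (t r + t r') / 2 * g r r' := by
      have h3 : hsSq (∑ r, W r) = ‖(hsSq (∑ r, W r) : ℂ)‖ := by
        rw [Complex.norm_real, Real.norm_of_nonneg (hsSq_nonneg _)]
      rw [h3, h1]
      refine (norm_sum_le _ _).trans (Finset.sum_le_sum fun r' _ => ?_)
      refine (norm_sum_le _ _).trans (Finset.sum_le_sum fun r _ => ?_)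
      refine (norm_trace_kraus_mul_le (hN r) (hN r') (z r) (z r') (hg r r')).trans ?_
      refine mul_le_mul_of_nonneg_right ?_ (hg r r').nonneg
      have := sq_nonneg (Real.sqrt (t r) - Real.sqrt (t r'))
      have e1 := Real.sq_sqrt (ht0 r)
      have e2 := Real.sq_sqrt (ht0 r')
      change Real.sqrt (t r) * Real.sqrt (t r') ≤ _
      nlinarith
    refine h2.trans ?_
    have h4 : ∑ r', ∑ r, (t r + t r') / 2 * g r r' = ∑ r, t r * ∑ r', g r r' := by
      have e1 : ∑ r', ∑ r, t r * g r r' = ∑ r, t r * ∑ r', g r r' := by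
        rw [Finset.sum_comm]; simp only [Finset.mul_sum]
      have e2 : ∑ r', ∑ r, t r' * g r r' = ∑ r, t r * ∑ r', g r r' := by
        simp only [Finset.mul_sum]
        exact Finset.sum_congr rfl fun r' _ => Finset.sum_congr rfl fun r _ => by rw [hsymm]
      have e3 : ∑ r', ∑ r, (t r + t r') / 2 * g r r' =
          (∑ r', ∑ r, t r * g r r' + ∑ r', ∑ r, t r' * g r r') / 2 := by
        simp only [← Finset.sum_add_distrib, Finset.sum_div]
        exact Finset.sum_congr rfl fun r' _ => Finset.sum_congr rfl fun r _ => by ring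
      rw [e3, e1, e2]; ring
    rw [h4, hT, Finset.mul_sum]
    refine Finset.sum_le_sum fun r _ => ?_
    rw [mul_comm]
    exact mul_le_mul_of_nonneg_right (hΛ r) (ht0 r)
  have hT0 : 0 ≤ T := Finset.sum_nonneg fun r _ => ht0 r
  have h5 : T ^ 2 ≤ Λ * T * hsSq ω := by
    have h6 := norm_trace_conjTranspose_mul_sq_le (∑ r, W r) ω
    rw [← hTW, Complex.norm_real, Real.norm_eq_abs, sq_abs] at h6
    exact h6.trans (mul_le_mul_of_nonneg_right hWW (hsSq_nonneg ω))
  -- If `T = 0` nothing can be cancelled, and nonnegativity of `Λ` is read off from a row sum, which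
  -- requires `R` to be nonempty.
  rcases hT0.eq_or_lt with h | h
  · rw [← h]
    obtain ⟨r⟩ := ‹Nonempty R›
    exact mul_nonneg ((Finset.sum_nonneg fun r' _ => (hg r r').nonneg).trans (hΛ r))
      (hsSq_nonneg ω)
  · have : T * T ≤ (Λ * hsSq ω) * T := by rw [← sq]; linarith
    exact le_of_mul_le_mul_right this h

end Overlap

/-! ### Independent copies -/

section Glue

variable {ι : Type} [DecidableEq ι]

/-- Joins two families indexed by the complementary parts of `ι`. -/
def glue {X : Type} (S : Finset ι) (f : {i // i ∈ S} → X) (g : {i // i ∉ S} → X) : ι → X :=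
  (Equiv.piEquivPiSubtypeProd (· ∈ S) fun _ => X).symm (f, g)

lemma glue_mem {X : Type} (S : Finset ι) (f : {i // i ∈ S} → X) (g : {i // i ∉ S} → X)
    (i : {i // i ∈ S}) : glue S f g i = f i := by
  simp [glue]

lemma glue_not_mem {X : Type} (S : Finset ι) (f : {i // i ∈ S} → X) (g : {i // i ∉ S} → X)
    (i : {i // i ∉ S}) : glue S f g i = g i := by
  simp [glue, i.2]

lemma sum_glue {X Y : Type} [Fintype ι] [Fintype X] [AddCommMonoid Y] (S : Finset ι)
    (F : (ι → X) → Y) :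
    ∑ f, F f = ∑ g : {i // i ∉ S} → X, ∑ f : {i // i ∈ S} → X, F (glue S f g) := by
  rw [← Equiv.sum_comp (Equiv.piEquivPiSubtypeProd (· ∈ S) fun _ => X).symm F,
    Fintype.sum_prod_type, Finset.sum_comm]
  rfl

lemma prod_glue {Y : Type} [Fintype ι] [CommMonoid Y] (S : Finset ι) (F : ι → Y) :
    ∏ i, F i = (∏ i : {i // i ∈ S}, F i) * ∏ i : {i // i ∉ S}, F i := by
  rw [← Fintype.prod_subtype_mul_prod_subtype (· ∈ S) F]
  congr
  exact Subsingleton.elim _ _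

end Glue

/-! ### Product tests on many copies of a bipartite vector -/

section Copies

variable {ι M E P : Type} [Fintype ι] [DecidableEq ι] [Fintype M] [Fintype E] [Fintype P]

/-- The expectation value `⟨v|O|v⟩` of a tensor product operator on copies of `M ⊗ E`. -/
def quadForm (O : ι → Matrix (M × E) (M × E) ℂ) (v : Matrix (ι → M) (ι → E) ℂ) : ℂ :=
  ∑ a : (ι → M) × (ι → E), ∑ b : (ι → M) × (ι → E),
    star (v a.1 a.2) * (∏ i, O i (a.1 i, a.2 i) (b.1 i, b.2 i)) * v b.1 b.2

/-- The rank one operator `|A⟩⟨A|` of a vector written as a matrix. -/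
def outer (A : Matrix M E ℂ) : Matrix (M × E) (M × E) ℂ :=
  Matrix.of fun a b => A a.1 a.2 * star (A b.1 b.2)

/-- The identity off S makes those indices diagonal, so they only label slices of v. On S the rank
one product turns each slice into a squared overlap, the form to which `sum_norm_overlap_sq_le`
applies. -/
lemma quadForm_subset [DecidableEq M] [DecidableEq E] (S : Finset ι) (A : ι → Matrix M E ℂ)
    (v : Matrix (ι → M) (ι → E) ℂ) :
    quadForm (fun i => if i ∈ S then outer (A i) else 1) v =
      ∑ μ : {i // i ∉ S} → M, ∑ ε : {i // i ∉ S} → E,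
        ((‖((piMat fun i : {i // i ∈ S} => A i)ᴴ *
          v.submatrix (glue S · μ) (glue S · ε)).trace‖ ^ 2 : ℝ) : ℂ) := by
  have hprod : ∀ (μ₁ μ₁' : {i // i ∈ S} → M) (μ₂ μ₂' : {i // i ∉ S} → M)
      (ε₁ ε₁' : {i // i ∈ S} → E) (ε₂ ε₂' : {i // i ∉ S} → E),
      (∏ i, (if i ∈ S then outer (A i) else 1 : Matrix (M × E) (M × E) ℂ)
        (glue S μ₁ μ₂ i, glue S ε₁ ε₂ i) (glue S μ₁' μ₂' i, glue S ε₁' ε₂' i)) =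
      (piMat (fun i : {i // i ∈ S} => A i) μ₁ ε₁ *
        star (piMat (fun i : {i // i ∈ S} => A i) μ₁' ε₁')) *
        (if μ₂ = μ₂' then if ε₂ = ε₂' then 1 else 0 else 0) := by
    intro μ₁ μ₁' μ₂ μ₂' ε₁ ε₁' ε₂ ε₂'
    rw [prod_glue S]
    congr 1
    · simp only [piMat_apply, star_prod, ← Finset.prod_mul_distrib]
      refine Finset.prod_congr rfl fun i _ => ?_
      rw [if_pos i.2, glue_mem, glue_mem, glue_mem, glue_mem]
      rfl
    · have : ∀ i : {i // i ∉ S}, (if (i : ι) ∈ S then outer (A i) else 1 : Matrix (M × E) (M × E) ℂ)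
          (glue S μ₁ μ₂ i, glue S ε₁ ε₂ i) (glue S μ₁' μ₂' i, glue S ε₁' ε₂' i) =
          if μ₂ i = μ₂' i ∧ ε₂ i = ε₂' i then 1 else 0 := by
        intro i
        rw [if_neg i.2, glue_not_mem, glue_not_mem, glue_not_mem, glue_not_mem, Matrix.one_apply]
        simp only [Prod.mk.injEq]
      rw [Finset.prod_congr rfl fun i _ => this i, Finset.prod_ite_zero, ← ite_and]
      simp only [Finset.mem_univ, true_implies, Finset.prod_const_one, forall_and, funext_iff]
  simp only [quadForm, Fintype.sum_prod_type]
  simp only [sum_glue (X := M) S, sum_glue (X := E) S, hprod]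
  refine Finset.sum_congr rfl fun μ₂ _ => ?_
  rw [Finset.sum_comm]
  refine Finset.sum_congr rfl fun ε₂ _ => ?_
  set X := piMat fun i : {i // i ∈ S} => A i
  set w := v.submatrix (glue S · μ₂) (glue S · ε₂)
  have hz : ((‖(Xᴴ * w).trace‖ ^ 2 : ℝ) : ℂ) = star (Xᴴ * w).trace * (Xᴴ * w).trace := by
    push_cast
    simpa using (Complex.conj_mul' ((Xᴴ * w).trace)).symm
  rw [hz, trace_conjTranspose_mul_eq_sum, star_sum, Finset.sum_mul]
  refine Finset.sum_congr rfl fun μ₁ _ => ?_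
  rw [star_sum, Finset.sum_mul]
  refine Finset.sum_congr rfl fun ε₁ _ => ?_
  rw [Finset.sum_eq_single μ₂ (fun μ₂' _ h => Finset.sum_eq_zero fun _ _ =>
    Finset.sum_eq_zero fun _ _ => Finset.sum_eq_zero fun _ _ => by
      rw [if_neg (Ne.symm h)]; simp) (by simp), Finset.mul_sum]
  refine Finset.sum_congr rfl fun μ₁' _ => ?_
  rw [Finset.sum_eq_single ε₂ (fun ε₂' _ h => Finset.sum_eq_zero fun _ _ => by
      rw [if_pos rfl, if_neg (Ne.symm h)]; simp) (by simp), Finset.mul_sum]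
  refine Finset.sum_congr rfl fun ε₁' _ => ?_
  rw [if_pos rfl, if_pos rfl]
  simp only [w, Matrix.submatrix_apply, star_mul', star_star, mul_one]
  ring

/-- If the two reduced states on `E` have fidelity at most `F`, the probability that all tests in
`S` succeed is at most `((1 + F) / 2) ^ |S|`, for one uniform coin per copy. -/
theorem sum_quadForm_subset_le [DecidableEq M] [DecidableEq E] [DecidableEq P]
    {J : (ι → Bool) → Type} [∀ r, Fintype (J r)]
    (A : Bool → Matrix M E ℂ) (hA : ∀ b, hsSq (A b) ≤ 1) {F : ℝ}
    (hF : NucBound (A true * (A false)ᴴ) F) (S : Finset ι)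
    (N : ∀ r, J r → Matrix (ι → M) P ℂ) (hN : ∀ r, ∑ j, (N r j)ᴴ * N r j = 1)
    (ω : Matrix P (ι → E) ℂ) :
    ∑ r, ∑ j, (quadForm (fun i => if i ∈ S then outer (A (r i)) else 1) (N r j * ω)).re ≤
      2 ^ Sᶜ.card * (1 + F) ^ S.card * hsSq ω := by
  have hF0 := hF.nonneg
  -- Gram bounds for one copy; each row sums to `1 + F`, hence the product over S has row sums `(1 +
  -- F) ^ S.card`.
  set g : Bool → Bool → ℝ := fun b b' => if b = b' then 1 else F with hg
  have hgA : ∀ b b', NucBound (A b * (A b')ᴴ) (g b b') := by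
    intro b b'
    rcases eq_or_ne b b' with rfl | h
    · simpa [hg] using nucBound_mul_conjTranspose (A b) (A b) (hA b) (hA b)
    · simp only [hg, if_neg h]
      cases b <;> cases b' <;> simp at h
      · simpa using hF.conjTranspose
      · exact hF
  have hrow : ∀ b, ∑ b', g b b' = 1 + F := by
    intro b; cases b <;> simp [hg, add_comm]
  -- The coins and E-indices off S are frozen. The M-indices off S are absorbed into the Kraus index
  -- of prover 1, so that the slices of the Kraus operators again form a complete family.
  have key : ∀ (s : {i // i ∉ S} → Bool) (ε : {i // i ∉ S} → E),
      ∑ r : {i // i ∈ S} → Bool, ∑ j : J (glue S r s) × ({i // i ∉ S} → M),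
        ‖((piMat fun i => A (r i))ᴴ * (((N (glue S r s) j.1).submatrix (glue S · j.2) id) *
          (ω.submatrix id (glue S · ε)))).trace‖ ^ 2 ≤
        (1 + F) ^ S.card * hsSq (ω.submatrix id (glue S · ε)) := by
    intro s ε
    refine sum_norm_overlap_sq_le (fun r : {i // i ∈ S} → Bool => piMat fun i => A (r i))
      (fun r r' => ∏ i, g (r i) (r' i)) ?_ ?_ ?_
      (fun r (j : J (glue S r s) × ({i // i ∉ S} → M)) =>
        (N (glue S r s) j.1).submatrix (glue S · j.2) id) ?_ _
    · intro r r'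
      rw [piMat_conjTranspose, piMat_mul]
      exact NucBound.piMat fun i => hgA _ _
    · intro r r'
      exact Finset.prod_congr rfl fun i _ => by simp only [hg, eq_comm]
    · intro r
      have := Finset.prod_univ_sum (fun _ : {i // i ∈ S} => (Finset.univ : Finset Bool))
        (fun i b => g (r i) b)
      rw [Fintype.piFinset_univ] at this
      rw [← this, Finset.prod_congr rfl fun i _ => hrow (r i)]
      simp
    · intro r
      rw [← hN (glue S r s), Fintype.sum_prod_type]
      refine Finset.sum_congr rfl fun j _ => ?_
      ext p q
      simp only [Matrix.sum_apply, Matrix.mul_apply, Matrix.conjTranspose_apply,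
        Matrix.submatrix_apply, id]
      exact (sum_glue S fun f => star (N (glue S r s) j f p) * N (glue S r s) j f q).symm
  have hω : ∑ ε : {i // i ∉ S} → E, hsSq (ω.submatrix id (glue S · ε)) = hsSq ω := by
    simp only [hsSq, Matrix.submatrix_apply, id]
    rw [Finset.sum_comm]
    exact Finset.sum_congr rfl fun p _ => (sum_glue S fun f => ‖ω p f‖ ^ 2).symm
  calc _ = ∑ s : {i // i ∉ S} → Bool, ∑ ε : {i // i ∉ S} → E,
        ∑ r : {i // i ∈ S} → Bool, ∑ j : J (glue S r s) × ({i // i ∉ S} → M),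
        ‖((piMat fun i => A (r i))ᴴ * (((N (glue S r s) j.1).submatrix (glue S · j.2) id) *
          (ω.submatrix id (glue S · ε)))).trace‖ ^ 2 := by
        rw [sum_glue S]
        refine Finset.sum_congr rfl fun s _ => ?_
        rw [Finset.sum_comm (s := Finset.univ) (t := Finset.univ)]
        refine Finset.sum_congr rfl fun r _ => ?_
        simp only [Fintype.sum_prod_type]
        rw [Finset.sum_comm]
        refine Finset.sum_congr rfl fun j _ => ?_
        rw [quadForm_subset S (fun i => A (glue S r s i)), Finset.sum_comm]
        simp only [← Complex.ofReal_sum, Complex.ofReal_re, glue_mem]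
        rfl
    _ ≤ ∑ s : {i // i ∉ S} → Bool, (1 + F) ^ S.card * hsSq ω := by
        refine Finset.sum_le_sum fun s _ => ?_
        rw [← hω, Finset.mul_sum]
        exact Finset.sum_le_sum fun ε _ => key s ε
    _ = _ := by
        rw [Finset.sum_const, nsmul_eq_mul, Finset.card_univ, Fintype.card_fun, Fintype.card_bool,
          Fintype.card_subtype_compl, Fintype.card_coe, Finset.card_compl]
        push_cast
        ring

end Copies

end QuantumCDS

end

noncomputable section

namespace QuantumCDS

/-! ### Threshold tests on independent copies -/

section Threshold

variable {ι M E P : Type} [Fintype ι] [DecidableEq ι] [Fintype M] [Fintype E] [Fintype P]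

lemma quadForm_eq_dotProduct (O : ι → Matrix (M × E) (M × E) ℂ)
    (v : Matrix (ι → M) (ι → E) ℂ) :
    quadForm O v = star (fun f : ι → M × E => v (fun i => (f i).1) (fun i => (f i).2)) ⬝ᵥ
      (piMat O *ᵥ fun f : ι → M × E => v (fun i => (f i).1) (fun i => (f i).2)) := by
  simp only [quadForm, dotProduct, Matrix.mulVec, Finset.mul_sum]
  rw [← Equiv.sum_comp (Equiv.arrowProdEquivProdArrow ι (fun _ => M) fun _ => E)]
  refine Finset.sum_congr rfl fun f _ => ?_
  rw [← Equiv.sum_comp (Equiv.arrowProdEquivProdArrow ι (fun _ => M) fun _ => E)]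
  refine Finset.sum_congr rfl fun g _ => ?_
  simp only [Equiv.arrowProdEquivProdArrow, Equiv.coe_fn_mk, Pi.star_apply, piMat_apply]
  ring

lemma quadForm_re_nonneg {O : ι → Matrix (M × E) (M × E) ℂ} (hO : ∀ i, (O i).PosSemidef)
    (v : Matrix (ι → M) (ι → E) ℂ) : 0 ≤ (quadForm O v).re := by
  rw [quadForm_eq_dotProduct]
  exact (Complex.nonneg_iff.1 ((piMat_posSemidef hO).dotProduct_mulVec_nonneg _)).1

lemma quadForm_add (X Y : ι → Matrix (M × E) (M × E) ℂ) (v : Matrix (ι → M) (ι → E) ℂ) :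
    quadForm (fun i => X i + Y i) v =
      ∑ S : Finset ι, quadForm (fun i => if i ∈ S then X i else Y i) v := by
  simp only [quadForm_eq_dotProduct, piMat_add, Matrix.sum_mulVec, dotProduct_sum]

lemma quadForm_smul_subset (S : Finset ι) (c : ℂ) (X Y : ι → Matrix (M × E) (M × E) ℂ)
    (v : Matrix (ι → M) (ι → E) ℂ) :
    quadForm (fun i => if i ∈ S then c • X i else Y i) v =
      c ^ S.card * quadForm (fun i => if i ∈ S then X i else Y i) v := by
  simp only [quadForm, Finset.mul_sum]
  refine Finset.sum_congr rfl fun a _ => Finset.sum_congr rfl fun b _ => ?_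
  have : ∏ i, (if i ∈ S then c • X i else Y i) (a.1 i, a.2 i) (b.1 i, b.2 i) =
      c ^ S.card * ∏ i, (if i ∈ S then X i else Y i) (a.1 i, a.2 i) (b.1 i, b.2 i) := by
    have h : ∀ i, (if i ∈ S then c • X i else Y i) (a.1 i, a.2 i) (b.1 i, b.2 i) =
        (if i ∈ S then c else 1) * (if i ∈ S then X i else Y i) (a.1 i, a.2 i) (b.1 i, b.2 i) := by
      intro i; split_ifs <;> simp
    simp only [h, Finset.prod_mul_distrib]
    simp
  rw [this]; ring

lemma outer_mul_outer {M E : Type} [Fintype M] [Fintype E] {A : Matrix M E ℂ} (hA : hsSq A = 1) :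
    outer A * outer A = outer A := by
  ext a b
  simp only [Matrix.mul_apply, outer, Matrix.of_apply]
  have h : ∑ c : M × E, star (A c.1 c.2) * A c.1 c.2 = 1 := by
    rw [Fintype.sum_prod_type' (f := fun i j => star (A i j) * A i j),
      ← trace_conjTranspose_mul_eq_sum, trace_conjTranspose_mul_self, hA]
    simp
  calc _ = (∑ c : M × E, star (A c.1 c.2) * A c.1 c.2) * (A a.1 a.2 * star (A b.1 b.2)) := by
        rw [Finset.sum_mul]; exact Finset.sum_congr rfl fun c _ => by ring
    _ = _ := by rw [h, one_mul]

lemma outer_conjTranspose {M E : Type} (A : Matrix M E ℂ) : (outer A)ᴴ = outer A := by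
  ext a b
  simp [outer, Matrix.conjTranspose_apply, mul_comm]

lemma outer_posSemidef {M E : Type} [Fintype M] [Fintype E] (A : Matrix M E ℂ) :
    (outer A).PosSemidef :=
  Matrix.posSemidef_vecMulVec_self_star fun a : M × E => A a.1 a.2

lemma one_sub_outer_posSemidef {M E : Type} [Fintype M] [Fintype E] [DecidableEq M]
    [DecidableEq E] {A : Matrix M E ℂ} (hA : hsSq A = 1) : (1 - outer A).PosSemidef := by
  have : 1 - outer A = (1 - outer A)ᴴ * (1 - outer A) := by
    rw [Matrix.conjTranspose_sub, Matrix.conjTranspose_one, outer_conjTranspose, Matrix.sub_mul,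
      Matrix.mul_sub, Matrix.mul_sub, outer_mul_outer hA]
    simp
  rw [this]
  exact Matrix.posSemidef_conjTranspose_mul_self _

/-- At least `T` of the tests `O i` succeed. -/
def thresholdOp {X : Type} [DecidableEq X] (T : ℕ) (O : ι → Matrix X X ℂ) :
    Matrix (ι → X) (ι → X) ℂ :=
  ∑ S : Finset ι with T ≤ S.card, piMat fun i => if i ∈ S then O i else 1 - O i

lemma thresholdOp_posSemidef {X : Type} [Fintype X] [DecidableEq X] (T : ℕ)
    {O : ι → Matrix X X ℂ} (h : ∀ i, (O i).PosSemidef) (h' : ∀ i, (1 - O i).PosSemidef) :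
    (thresholdOp T O).PosSemidef :=
  Matrix.posSemidef_sum _ fun S _ => piMat_posSemidef fun i => by
    split_ifs
    exacts [h i, h' i]

lemma one_sub_thresholdOp {X : Type} [Fintype X] [DecidableEq X] (T : ℕ) (O : ι → Matrix X X ℂ) :
    1 - thresholdOp T O =
      ∑ S : Finset ι with ¬ T ≤ S.card, piMat fun i => if i ∈ S then O i else 1 - O i := by
  have h := piMat_add O (fun i => 1 - O i)
  simp only [add_sub_cancel, piMat_one] at h
  rw [h, thresholdOp, ← Finset.sum_filter_add_sum_filter_not Finset.univ
    (fun S : Finset ι => T ≤ S.card)]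
  simp

lemma one_sub_thresholdOp_posSemidef {X : Type} [Fintype X] [DecidableEq X] (T : ℕ)
    {O : ι → Matrix X X ℂ} (h : ∀ i, (O i).PosSemidef) (h' : ∀ i, (1 - O i).PosSemidef) :
    (1 - thresholdOp T O).PosSemidef := by
  rw [one_sub_thresholdOp]
  exact Matrix.posSemidef_sum _ fun S _ => piMat_posSemidef fun i => by
    split_ifs
    exacts [h i, h' i]

/-- The expectation value `⟨v|O|v⟩` on one copy. -/
def quadOne (O : Matrix (M × E) (M × E) ℂ) (v : Matrix M E ℂ) : ℂ :=
  ∑ a : M × E, ∑ b : M × E, star (v a.1 a.2) * O a b * v b.1 b.2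

lemma quadForm_piMat (O : ι → Matrix (M × E) (M × E) ℂ) (v : ι → Matrix M E ℂ) :
    quadForm O (piMat v) = ∏ i, quadOne (O i) (v i) := by
  simp only [quadOne]
  rw [quadForm, ← Equiv.sum_comp (Equiv.arrowProdEquivProdArrow ι (fun _ => M) fun _ => E)]
  simp only [← Equiv.sum_comp (Equiv.arrowProdEquivProdArrow ι (fun _ => M) fun _ => E)
    (fun b => star (piMat v _ _) * _ * piMat v b.1 b.2)]
  rw [Finset.prod_univ_sum, Fintype.piFinset_univ]
  refine Finset.sum_congr rfl fun f _ => ?_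
  rw [Finset.prod_univ_sum, Fintype.piFinset_univ]
  refine Finset.sum_congr rfl fun g _ => ?_
  simp only [Equiv.arrowProdEquivProdArrow, Equiv.coe_fn_mk, piMat_apply, star_prod,
    Finset.prod_mul_distrib]

lemma quadOne_outer (A v : Matrix M E ℂ) :
    quadOne (outer A) v = ((‖(Aᴴ * v).trace‖ ^ 2 : ℝ) : ℂ) := by
  have hz : ((‖(Aᴴ * v).trace‖ ^ 2 : ℝ) : ℂ) = star (Aᴴ * v).trace * (Aᴴ * v).trace := by
    push_cast
    simpa using (Complex.conj_mul' ((Aᴴ * v).trace)).symm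
  rw [hz, trace_conjTranspose_mul_eq_sum, ← Fintype.sum_prod_type', star_sum, Finset.sum_mul_sum,
    quadOne]
  refine Finset.sum_congr rfl fun a _ => Finset.sum_congr rfl fun b _ => ?_
  simp only [outer, Matrix.of_apply, star_mul', star_star]
  ring

variable [DecidableEq M] [DecidableEq E] [DecidableEq P]

/-- Exponential Markov inequality: on outcomes with at least T successes, 3 ^ T is at most 3 to the
number of successes. The latter has operator ⨂(3 O + (1 - O)) = ⨂(1 + 2 O), whose expansion contains
only the events "all tests in S succeed". -/
lemma three_pow_mul_sum_threshold_le {O : ι → Matrix (M × E) (M × E) ℂ}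
    (h : ∀ i, (O i).PosSemidef) (h' : ∀ i, (1 - O i).PosSemidef) (T : ℕ)
    (v : Matrix (ι → M) (ι → E) ℂ) :
    3 ^ T * ∑ S : Finset ι with T ≤ S.card,
        (quadForm (fun i => if i ∈ S then O i else 1 - O i) v).re ≤
      ∑ S : Finset ι, 2 ^ S.card * (quadForm (fun i => if i ∈ S then O i else 1) v).re := by
  have e1 : ∑ S : Finset ι, 2 ^ S.card * (quadForm (fun i => if i ∈ S then O i else 1) v).re =
      ∑ S : Finset ι, 3 ^ S.card *
        (quadForm (fun i => if i ∈ S then O i else 1 - O i) v).re := by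
    have e2 := quadForm_add (fun i => (2 : ℂ) • O i) (fun _ => 1) v
    have e3 := quadForm_add (fun i => (3 : ℂ) • O i) (fun i => 1 - O i) v
    have e4 : (fun i => (2 : ℂ) • O i + 1) = fun i => (3 : ℂ) • O i + (1 - O i) := by
      funext i; module
    rw [e4, e3] at e2
    simp only [quadForm_smul_subset] at e2
    have e5 := congrArg Complex.re e2
    simp only [Complex.re_sum] at e5
    have e6 : ∀ (k m : ℕ) (w : ℂ), (((m : ℕ) : ℂ) ^ k * w).re = ((m : ℕ) : ℝ) ^ k * w.re := by
      intro k m w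
      rw [← Complex.ofReal_natCast, ← Complex.ofReal_pow, Complex.re_ofReal_mul]
    refine Eq.trans (Finset.sum_congr rfl fun S _ => ?_) (e5.symm.trans
      (Finset.sum_congr rfl fun S _ => ?_))
    · exact_mod_cast (e6 S.card 2 _).symm
    · exact_mod_cast e6 S.card 3 _
  have h0 : ∀ S : Finset ι, 0 ≤ (quadForm (fun i => if i ∈ S then O i else 1 - O i) v).re :=
    fun S => quadForm_re_nonneg (fun i => by split_ifs; exacts [h i, h' i]) v
  rw [e1, Finset.mul_sum]
  refine le_trans (Finset.sum_le_sum fun S hS => ?_) (Finset.sum_le_sum_of_subset_of_nonneg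
    (Finset.filter_subset (fun S : Finset ι => T ≤ S.card) Finset.univ)
    fun S _ _ => mul_nonneg (by positivity) (h0 S))
  exact mul_le_mul_of_nonneg_right
    (pow_le_pow_right₀ (by norm_num) (Finset.mem_filter.1 hS).2) (h0 S)

/-- Soundness of the threshold test. -/
theorem sum_threshold_le {J : (ι → Bool) → Type} [∀ r, Fintype (J r)]
    (A : Bool → Matrix M E ℂ) (hA : ∀ b, hsSq (A b) = 1) {F : ℝ}
    (hF : NucBound (A true * (A false)ᴴ) F) (T : ℕ)
    (N : ∀ r, J r → Matrix (ι → M) P ℂ) (hN : ∀ r, ∑ j, (N r j)ᴴ * N r j = 1)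
    (ω : Matrix P (ι → E) ℂ) :
    3 ^ T * ∑ r : ι → Bool, ∑ j, ∑ S : Finset ι with T ≤ S.card,
        (quadForm (fun i => if i ∈ S then outer (A (r i)) else 1 - outer (A (r i)))
          (N r j * ω)).re ≤
      (4 + 2 * F) ^ Fintype.card ι * hsSq ω := by
  calc _ ≤ ∑ r : ι → Bool, ∑ j, ∑ S : Finset ι, 2 ^ S.card *
        (quadForm (fun i => if i ∈ S then outer (A (r i)) else 1) (N r j * ω)).re := by
        simp only [Finset.mul_sum (a := (3 : ℝ) ^ T) (s := (Finset.univ : Finset (ι → Bool)))]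
        refine Finset.sum_le_sum fun r _ => ?_
        rw [Finset.mul_sum]
        exact Finset.sum_le_sum fun j _ => three_pow_mul_sum_threshold_le
          (fun i => outer_posSemidef _) (fun i => one_sub_outer_posSemidef (hA _)) T _
    _ = ∑ S : Finset ι, 2 ^ S.card * ∑ r : ι → Bool, ∑ j,
        (quadForm (fun i => if i ∈ S then outer (A (r i)) else 1) (N r j * ω)).re := by
        simp only [Finset.mul_sum]
        rw [Finset.sum_comm (s := (Finset.univ : Finset (Finset ι)))]
        exact Finset.sum_congr rfl fun r _ => Finset.sum_comm
    _ ≤ ∑ S : Finset ι, 2 ^ S.card * (2 ^ Sᶜ.card * (1 + F) ^ S.card * hsSq ω) := by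
        refine Finset.sum_le_sum fun S _ => mul_le_mul_of_nonneg_left ?_ (by positivity)
        exact sum_quadForm_subset_le A (fun b => (hA b).le) hF S N hN ω
    _ = (∑ S : Finset ι, (2 * (1 + F)) ^ S.card * 2 ^ (Fintype.card ι - S.card)) * hsSq ω := by
        rw [Finset.sum_mul]
        refine Finset.sum_congr rfl fun S _ => ?_
        rw [Finset.card_compl, mul_pow]; ring
    _ = _ := by
        -- Binomial theorem over subsets, with base `2 * (1 + F) + 2 = 4 + 2 * F`.
        rw [Fintype.sum_pow_mul_eq_add_pow]
        ring

lemma quadOne_one (v : Matrix M E ℂ) : quadOne 1 v = hsSq v := by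
  rw [← trace_conjTranspose_mul_self, trace_conjTranspose_mul_eq_sum, ← Fintype.sum_prod_type',
    quadOne]
  refine Finset.sum_congr rfl fun a _ => ?_
  rw [Finset.sum_eq_single a (fun b _ hb => by simp [Matrix.one_apply_ne (Ne.symm hb)]) (by simp)]
  simp

lemma quadOne_one_sub (O : Matrix (M × E) (M × E) ℂ) (v : Matrix M E ℂ) :
    quadOne (1 - O) v = hsSq v - quadOne O v := by
  rw [← quadOne_one]
  simp only [quadOne, ← Finset.sum_sub_distrib]
  refine Finset.sum_congr rfl fun a _ => Finset.sum_congr rfl fun b _ => ?_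
  simp only [Matrix.sub_apply]; ring

/-- Completeness of the threshold test, for a strategy that treats the copies independently. -/
theorem sum_not_threshold_le {J : Type} [Fintype J]
    (A : Bool → Matrix M E ℂ) (hA : ∀ b, hsSq (A b) = 1) (N : Bool → J → Matrix M M ℂ)
    (hN : ∀ b, ∑ j, (N b j)ᴴ * N b j = 1) (L : ℕ) (hL : Fintype.card ι = 4 * L) {p : Bool → ℝ}
    (hp : ∀ b, p b ≤ ∑ j, ‖((A b)ᴴ * (N b j * A false)).trace‖ ^ 2) :
    3 ^ L * ∑ r : ι → Bool, ∑ j : ι → J, ∑ S : Finset ι with ¬ 3 * L ≤ S.card,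
        (quadForm (fun i => if i ∈ S then outer (A (r i)) else 1 - outer (A (r i)))
          (piMat fun i => N (r i) (j i) * A false)).re ≤
      (∑ b, (3 - 2 * p b)) ^ Fintype.card ι := by
  set q : Bool → ℝ := fun b => ∑ j, ‖((A b)ᴴ * (N b j * A false)).trace‖ ^ 2 with hq
  have hs : ∀ b, ∑ j, hsSq (N b j * A false) = 1 := fun b => by
    rw [sum_hsSq_kraus_mul (hN b), hA]
  have hq1 : ∀ b, q b ≤ 1 := by
    intro b
    rw [← hs b]
    refine Finset.sum_le_sum fun j _ => ?_
    refine (norm_trace_conjTranspose_mul_sq_le _ _).trans ?_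
    rw [hA, one_mul]
  have hq0 : ∀ b, 0 ≤ q b := fun b => Finset.sum_nonneg fun _ _ => by positivity
  have hform : ∀ (r : ι → Bool) (S : Finset ι), ∑ j : ι → J,
      (quadForm (fun i => if i ∈ S then outer (A (r i)) else 1 - outer (A (r i)))
          (piMat fun i => N (r i) (j i) * A false)).re =
      ∏ i, if i ∈ S then q (r i) else 1 - q (r i) := by
    intro r S
    have h1 : ∀ i, ∑ j, quadOne (if i ∈ S then outer (A (r i)) else 1 - outer (A (r i)))
        (N (r i) j * A false) = ((if i ∈ S then q (r i) else 1 - q (r i) : ℝ) : ℂ) := by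
      intro i
      split_ifs
      · simp only [quadOne_outer, hq]; push_cast; rfl
      · simp only [quadOne_one_sub, quadOne_outer, Finset.sum_sub_distrib, ← Complex.ofReal_sum, hs,
          hq]
        push_cast; rfl
    simp only [quadForm_piMat]
    rw [← Complex.re_sum]
    have h2 := Finset.prod_univ_sum (fun _ : ι => (Finset.univ : Finset J)) (fun i j =>
      quadOne (if i ∈ S then outer (A (r i)) else 1 - outer (A (r i))) (N (r i) j * A false))
    rw [Fintype.piFinset_univ] at h2
    rw [← h2, Finset.prod_congr rfl fun i _ => h1 i, ← Complex.ofReal_prod, Complex.ofReal_re]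
  calc _ = ∑ r : ι → Bool, ∑ S : Finset ι with ¬ 3 * L ≤ S.card,
        3 ^ L * ∏ i, (if i ∈ S then q (r i) else 1 - q (r i)) := by
        rw [Finset.mul_sum]
        refine Finset.sum_congr rfl fun r _ => ?_
        rw [Finset.sum_comm, Finset.mul_sum]
        exact Finset.sum_congr rfl fun S _ => by rw [hform]
    -- Of `4 * L` tests fewer than `3 * L` succeed, so more than `L` fail. Giving each failure
    -- weight 3 pays for the factor `3 ^ L`, and extending to all `S` makes the sum factor over the
    -- copies.
    _ ≤ ∑ r : ι → Bool, ∑ S : Finset ι,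
        ∏ i, (if i ∈ S then q (r i) else 3 * (1 - q (r i))) := by
        have h0 : ∀ (r : ι → Bool) (S : Finset ι), 0 ≤
            ∏ i, (if i ∈ S then q (r i) else 1 - q (r i)) := fun r S =>
          Finset.prod_nonneg fun i _ => by
            split_ifs
            exacts [hq0 _, sub_nonneg.2 (hq1 _)]
        have h3 : ∀ (r : ι → Bool) (S : Finset ι),
            ∏ i, (if i ∈ S then q (r i) else 3 * (1 - q (r i))) =
            3 ^ Sᶜ.card * ∏ i, (if i ∈ S then q (r i) else 1 - q (r i)) := by
          intro r S
          have : ∀ i, (if i ∈ S then q (r i) else 3 * (1 - q (r i))) =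
              (if i ∈ Sᶜ then 3 else 1) * (if i ∈ S then q (r i) else 1 - q (r i)) := by
            intro i
            by_cases hi : i ∈ S <;> simp [hi]
          rw [Finset.prod_congr rfl fun i _ => this i, Finset.prod_mul_distrib]
          congr 1
          rw [Finset.prod_ite_mem, Finset.univ_inter, Finset.prod_const]
        refine Finset.sum_le_sum fun r _ => ?_
        refine le_trans (Finset.sum_le_sum fun S hS => ?_) (Finset.sum_le_sum_of_subset_of_nonneg
          (Finset.filter_subset (fun S : Finset ι => ¬ 3 * L ≤ S.card) Finset.univ)
          fun S _ _ => by rw [h3]; exact mul_nonneg (by positivity) (h0 r S))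
        rw [h3]
        refine mul_le_mul_of_nonneg_right (pow_le_pow_right₀ (by norm_num) ?_) (h0 r S)
        have := (Finset.mem_filter.1 hS).2
        rw [Finset.card_compl]
        omega
    _ = ∑ r : ι → Bool, ∏ i, (3 - 2 * q (r i)) := by
        refine Finset.sum_congr rfl fun r _ => ?_
        have : ∀ i, 3 - 2 * q (r i) = q (r i) + 3 * (1 - q (r i)) := fun i => by ring
        simp only [this, Finset.prod_add, Finset.powerset_univ]
        refine Finset.sum_congr rfl fun S _ => ?_
        rw [← Finset.prod_mul_prod_compl S, Finset.compl_eq_univ_sdiff]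
        congr 1
        · exact Finset.prod_congr rfl fun i hi => by rw [if_pos hi]
        · exact Finset.prod_congr rfl fun i hi => by rw [if_neg (by simpa using hi)]
    _ = (∑ b, (3 - 2 * q b)) ^ Fintype.card ι := by
        have h2 := Finset.prod_univ_sum (fun _ : ι => (Finset.univ : Finset Bool))
          (fun _ b => 3 - 2 * q b)
        rw [Fintype.piFinset_univ] at h2
        rw [← h2, Finset.prod_const, Finset.card_univ]
    _ ≤ _ := by
        refine pow_le_pow_left₀ (Finset.sum_nonneg fun b _ => by linarith [hq1 b]) ?_ _
        exact Finset.sum_le_sum fun b _ => by linarith [hp b]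

end Threshold

end QuantumCDS

end

noncomputable section

namespace QuantumCDS

/-! ### Kraus operators -/

section Kraus

variable {ι κ γ J : Type} [Fintype ι] [DecidableEq ι] [Fintype κ] [Fintype γ] [Fintype J]

/-- Every channel has a Kraus representation with at most `dim κ * dim ι` operators. -/
lemma IsChannel.exists_kraus {Φ : Matrix ι ι ℂ →ₗ[ℂ] Matrix κ κ ℂ} (h : IsChannel Φ) :
    ∃ K : κ × ι → Matrix κ ι ℂ,
      (∀ X, Φ X = ∑ e, K e * X * (K e)ᴴ) ∧ ∑ e, (K e)ᴴ * K e = 1 := by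
  obtain ⟨m, K, hK, hK1⟩ := h
  -- `B * Bᴴ` is the Choi matrix, which determines both the channel and the normalisation. Any other
  -- factor of it is again a Kraus family, and a square factor has `κ × ι` columns. The size matters
  -- because the environments become messages of the provers and enter the cost.
  set B : Matrix (κ × ι) (Fin m) ℂ := Matrix.of fun a e => K e a.1 a.2
  obtain ⟨D, hD⟩ := exists_eq_mul_conjTranspose (Matrix.posSemidef_self_mul_conjTranspose B)
  have hBD : ∀ a b, ∑ e, K e a.1 a.2 * star (K e b.1 b.2) = ∑ e, D a e * star (D b e) := by
    intro a b
    simpa [Matrix.mul_apply, B] using congrFun₂ hD a b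
  refine ⟨fun e => Matrix.of fun k i => D (k, i) e, fun X => ?_, ?_⟩
  · have aux : ∀ {J : Type} [Fintype J] (F : J → Matrix κ ι ℂ) (k l : κ),
        (∑ e, F e * X * (F e)ᴴ) k l = ∑ j, ∑ i, (∑ e, F e k i * star (F e l j)) * X i j := by
      intro J _ F k l
      simp only [Matrix.sum_apply, Matrix.mul_apply, Matrix.conjTranspose_apply, Finset.sum_mul]
      rw [Finset.sum_comm]
      refine Finset.sum_congr rfl fun j _ => ?_
      rw [Finset.sum_comm]
      exact Finset.sum_congr rfl fun i _ => Finset.sum_congr rfl fun e _ => by ring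
    ext k l
    rw [hK, aux, aux]
    refine Finset.sum_congr rfl fun j _ => Finset.sum_congr rfl fun i _ => ?_
    rw [hBD (k, i) (l, j)]
    rfl
  · rw [← hK1]
    ext i j
    simp only [Matrix.sum_apply, Matrix.mul_apply, Matrix.conjTranspose_apply, Matrix.of_apply]
    rw [Finset.sum_comm, Finset.sum_comm (s := (Finset.univ : Finset (Fin m)))]
    refine Finset.sum_congr rfl fun k _ => ?_
    have := hBD (k, j) (k, i)
    simp only [mul_comm (K _ _ _), mul_comm (D _ _)] at this
    exact this.symm

lemma onLeft_eq_sum {ι κ γ J : Type} [Fintype ι] [Fintype κ] [Fintype γ] [DecidableEq γ]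
    [Fintype J] {Φ : Matrix ι ι ℂ →ₗ[ℂ] Matrix κ κ ℂ} {K : J → Matrix κ ι ℂ}
    (hK : ∀ X, Φ X = ∑ e, K e * X * (K e)ᴴ) (X : Matrix (ι × γ) (ι × γ) ℂ) :
    onLeft Φ X = ∑ e, (K e ⊗ₖ (1 : Matrix γ γ ℂ)) * X * (K e ⊗ₖ (1 : Matrix γ γ ℂ))ᴴ := by
  ext ⟨k, c⟩ ⟨l, d⟩
  simp only [onLeft, Matrix.of_apply, hK, Matrix.sum_apply]
  refine Finset.sum_congr rfl fun e _ => ?_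
  simp [Matrix.mul_apply, Fintype.sum_prod_type, Matrix.kroneckerMap_apply, Matrix.one_apply,
    Finset.sum_mul, apply_ite (starRingEnd ℂ)]

lemma onRight_eq_sum {ι κ γ J : Type} [Fintype ι] [Fintype κ] [Fintype γ] [DecidableEq γ]
    [Fintype J] {Φ : Matrix ι ι ℂ →ₗ[ℂ] Matrix κ κ ℂ} {K : J → Matrix κ ι ℂ}
    (hK : ∀ X, Φ X = ∑ e, K e * X * (K e)ᴴ) (X : Matrix (γ × ι) (γ × ι) ℂ) :
    onRight Φ X = ∑ e, ((1 : Matrix γ γ ℂ) ⊗ₖ K e) * X * ((1 : Matrix γ γ ℂ) ⊗ₖ K e)ᴴ := by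
  ext ⟨c, k⟩ ⟨d, l⟩
  simp only [onRight, Matrix.of_apply, hK, Matrix.sum_apply]
  refine Finset.sum_congr rfl fun e _ => ?_
  simp only [Matrix.mul_apply, Fintype.sum_prod_type, Matrix.kroneckerMap_apply, Matrix.one_apply,
    Matrix.conjTranspose_apply, Matrix.of_apply]
  rw [Finset.sum_eq_single d (fun b _ hb => by simp [Ne.symm hb]) (by simp)]
  simp [Finset.sum_mul]

lemma onRight_posSemidef {Φ : Matrix ι ι ℂ →ₗ[ℂ] Matrix κ κ ℂ} (h : IsChannel Φ)
    {X : Matrix (γ × ι) (γ × ι) ℂ} (hX : X.PosSemidef) : (onRight Φ X).PosSemidef := by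
  classical
  obtain ⟨m, K, hK, -⟩ := h
  rw [onRight_eq_sum hK]
  exact Matrix.posSemidef_sum _ fun e _ => hX.mul_mul_conjTranspose_same _

lemma IsChannel.trace_eq {Φ : Matrix ι ι ℂ →ₗ[ℂ] Matrix κ κ ℂ} (h : IsChannel Φ)
    (X : Matrix ι ι ℂ) : (Φ X).trace = X.trace := by
  obtain ⟨m, K, hK, hK1⟩ := h
  rw [hK, Matrix.trace_sum]
  simp only [Matrix.trace_mul_comm _ (K _)ᴴ, ← Matrix.mul_assoc]
  rw [← Matrix.trace_sum, ← Matrix.sum_mul, hK1, Matrix.one_mul]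

lemma trace_onRight {Φ : Matrix ι ι ℂ →ₗ[ℂ] Matrix κ κ ℂ} (h : IsChannel Φ)
    (X : Matrix (γ × ι) (γ × ι) ℂ) : (onRight Φ X).trace = X.trace := by
  simp only [Matrix.trace, Matrix.diag_apply, Fintype.sum_prod_type]
  exact Finset.sum_congr rfl fun c _ =>
    h.trace_eq (Matrix.of fun i j => X (c, i) (c, j))

end Kraus

/-! ### Consequences of a small diamond distance -/

section Diamond

variable {ι κ : Type} [Fintype ι] [Fintype κ] [DecidableEq κ]

/-- A one-dimensional reference suffices: the proof uses the diamond norm only on superpositions of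
the two secrets. -/
lemma nucBound_of_diamondDist_le {Φ Ψ : Matrix ι ι ℂ →ₗ[ℂ] Matrix κ κ ℂ} {ε : ℝ} (hε : 0 ≤ ε)
    (h : diamondDist Φ Ψ ≤ ENNReal.ofReal ε) {ρ : Matrix ι ι ℂ} (hρ : IsDensity ρ) :
    NucBound (Φ ρ - Ψ ρ) ε := by
  set ρ' : Matrix (Fin 1 × ι) (Fin 1 × ι) ℂ := ρ.submatrix Prod.snd Prod.snd
  have hρ' : IsDensity ρ' := by
    refine ⟨hρ.1.submatrix _, ?_⟩
    rw [← hρ.2]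
    simp [Matrix.trace, ρ', Fintype.sum_prod_type]
  have h1 : ENNReal.ofReal (traceNorm (onRight Φ ρ' - onRight Ψ ρ')) ≤ ENNReal.ofReal ε :=
    le_trans (le_iSup₂_of_le (f := fun (d : ℕ) (ρ : Matrix (Fin d × ι) (Fin d × ι) ℂ) =>
      ⨆ _ : IsDensity ρ, ENNReal.ofReal (traceNorm (onRight Φ ρ - onRight Ψ ρ))) 1 ρ'
      (le_iSup_of_le hρ' le_rfl)) h
  rw [ENNReal.ofReal_le_ofReal_iff hε] at h1
  have h2 := (nucBound_traceNorm (onRight Φ ρ' - onRight Ψ ρ')).mono h1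
  exact h2.submatrix (e := fun k => (0, k)) (e' := fun k => (0, k))
    (fun a b hab => (Prod.mk.inj hab).2) (fun a b hab => (Prod.mk.inj hab).2)

/-- The pure state `(|0⟩ + z|1⟩) / √2` as a density matrix. -/
def phaseState (z : ℂ) : Matrix (Fin 2) (Fin 2) ℂ := !![1 / 2, star z / 2; z / 2, 1 / 2]

lemma phaseState_isDensity {z : ℂ} (hz : star z * z = 1) : IsDensity (phaseState z) := by
  constructor
  · have h : phaseState z = (1 / 2 : ℂ) • Matrix.vecMulVec ![1, z] (star ![1, z]) := by
      have hz' : z * star z = 1 := by rw [mul_comm]; exact hz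
      ext i j
      rw [Matrix.smul_apply, Matrix.vecMulVec_apply, Pi.star_apply]
      fin_cases i <;> fin_cases j
      · simp [phaseState]
      · simp [phaseState]; ring
      · simp [phaseState]; ring
      · change (1 / 2 : ℂ) = (1 / 2) * (z * star z)
        rw [hz', mul_one]
    rw [h]
    refine Matrix.PosSemidef.smul (Matrix.posSemidef_vecMulVec_self_star _) ?_
    rw [Complex.nonneg_iff]; norm_num
  · simp [phaseState, Matrix.trace_fin_two]; norm_num

end Diamond

/-! ### The purified protocol -/

namespace CDQSProtocol

variable {n : ℕ} (P : CDQSProtocol n)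

/-- Environment of Alice's channels. -/
abbrev EnvA : Type := Fin P.dA × (Fin 2 × Fin P.dL)
/-- Environment of Bob's channels. -/
abbrev EnvB : Type := Fin P.dB × Fin P.dR
/-- Purifying system of the resource. -/
abbrev EnvS : Type := Fin P.dL × Fin P.dR

/-- Kraus operators of Alice's channels. -/
def aliceKraus (x : Bits n) : P.EnvA → Matrix (Fin P.dA) (Fin 2 × Fin P.dL) ℂ :=
  (P.alice x).isChannel.exists_kraus.choose

lemma aliceKraus_spec (x : Bits n) (X) :
    (P.alice x).toLin X = ∑ e, P.aliceKraus x e * X * (P.aliceKraus x e)ᴴ :=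
  (P.alice x).isChannel.exists_kraus.choose_spec.1 X

lemma aliceKraus_sum (x : Bits n) : ∑ e, (P.aliceKraus x e)ᴴ * P.aliceKraus x e = 1 :=
  (P.alice x).isChannel.exists_kraus.choose_spec.2

/-- Kraus operators of Bob's channels. -/
def bobKraus (y : Bits n) : P.EnvB → Matrix (Fin P.dB) (Fin P.dR) ℂ :=
  (P.bob y).isChannel.exists_kraus.choose

lemma bobKraus_spec (y : Bits n) (X) :
    (P.bob y).toLin X = ∑ e, P.bobKraus y e * X * (P.bobKraus y e)ᴴ :=
  (P.bob y).isChannel.exists_kraus.choose_spec.1 X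

lemma bobKraus_sum (y : Bits n) : ∑ e, (P.bobKraus y e)ᴴ * P.bobKraus y e = 1 :=
  (P.bob y).isChannel.exists_kraus.choose_spec.2

/-- A purification of the resource state. -/
def purification : Matrix (Fin P.dL × Fin P.dR) P.EnvS ℂ :=
  (exists_eq_mul_conjTranspose P.resource_isDensity.1).choose

lemma purification_spec : P.resource = P.purification * P.purificationᴴ :=
  (exists_eq_mul_conjTranspose P.resource_isDensity.1).choose_spec

/-- The basis state `q` of the secret together with the purified resource. -/
def attachBasis (q : Fin 2) : Matrix ((Fin 2 × Fin P.dL) × Fin P.dR) P.EnvS ℂ :=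
  Matrix.of fun p g => if p.1.1 = q then P.purification (p.1.2, p.2) g else 0

lemma attach_eq_sum (X : Matrix (Fin 2) (Fin 2) ℂ) :
    P.attach X = ∑ q, ∑ q', X q q' • (P.attachBasis q * (P.attachBasis q')ᴴ) := by
  ext ⟨⟨q, l⟩, r⟩ ⟨⟨q', l'⟩, r'⟩
  simp only [Matrix.sum_apply, Matrix.smul_apply, Matrix.mul_apply, Matrix.conjTranspose_apply,
    attachBasis, Matrix.of_apply, smul_eq_mul]
  rw [Finset.sum_eq_single q (fun b _ hb => by simp [Ne.symm hb]) (by simp),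
    Finset.sum_eq_single q' (fun b _ hb => by simp [Ne.symm hb]) (by simp)]
  simp only [if_true]
  change X q q' * P.resource (l, r) (l', r') = _
  rw [P.purification_spec]
  rfl

lemma hsSq_attachBasis (q : Fin 2) : hsSq (P.attachBasis q) = 1 := by
  have h : hsSq P.purification = 1 := by
    have h1 : (hsSq P.purification : ℂ) = 1 := by
      rw [← trace_conjTranspose_mul_self, Matrix.trace_mul_comm, ← P.purification_spec,
        P.resource_isDensity.2]
    exact_mod_cast h1
  rw [← h]
  simp only [hsSq, attachBasis, Matrix.of_apply, Fintype.sum_prod_type]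
  rw [Finset.sum_eq_single q (fun b _ hb => by simp [hb]) (by simp)]
  simp

/-- The pure state of messages and environments on the basis state `q` of the secret, as a matrix
from the environments to the messages. -/
def pureOutput (x y : Bits n) (q : Fin 2) :
    Matrix (Fin P.dA × Fin P.dB) ((P.EnvA × P.EnvS) × P.EnvB) ℂ :=
  Matrix.of fun m e =>
    ((P.aliceKraus x e.1.1 ⊗ₖ P.bobKraus y e.2) * P.attachBasis q) m e.1.2

lemma pureOutput_mul_conjTranspose (x y : Bits n) (q q' : Fin 2) :
    P.pureOutput x y q * (P.pureOutput x y q')ᴴ =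
      ∑ e' : P.EnvB, ∑ e : P.EnvA, ((P.aliceKraus x e ⊗ₖ P.bobKraus y e') * P.attachBasis q) *
        ((P.aliceKraus x e ⊗ₖ P.bobKraus y e') * P.attachBasis q')ᴴ := by
  ext m m'
  rw [Matrix.mul_apply, Fintype.sum_prod_type_right, Matrix.sum_apply]
  refine Finset.sum_congr rfl fun e' _ => ?_
  rw [Fintype.sum_prod_type, Matrix.sum_apply]
  rfl

/-- Tracing out the environments of the purified output recovers the protocol. By linearity the
off-diagonal unit |q⟩⟨q'| is sent to A_q A_q'ᴴ, which links correctness and security to overlaps of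
the pure outputs. -/
lemma encode_eq_sum (x y : Bits n) (X : Matrix (Fin 2) (Fin 2) ℂ) :
    P.encode x y X =
      ∑ q, ∑ q', X q q' • (P.pureOutput x y q * (P.pureOutput x y q')ᴴ) := by
  have h1 : P.encode x y X = ∑ e' : P.EnvB, ∑ e : P.EnvA,
      (P.aliceKraus x e ⊗ₖ P.bobKraus y e') * P.attach X *
        (P.aliceKraus x e ⊗ₖ P.bobKraus y e')ᴴ := by
    change onRight (P.bob y).toLin (onLeft (P.alice x).toLin (P.attach X)) = _
    rw [onRight_eq_sum (P.bobKraus_spec y), onLeft_eq_sum (P.aliceKraus_spec x)]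
    refine Finset.sum_congr rfl fun e' _ => ?_
    rw [Matrix.mul_sum, Matrix.sum_mul]
    refine Finset.sum_congr rfl fun e _ => ?_
    have h2 : P.aliceKraus x e ⊗ₖ P.bobKraus y e' =
        ((1 : Matrix (Fin P.dA) (Fin P.dA) ℂ) ⊗ₖ P.bobKraus y e') *
          (P.aliceKraus x e ⊗ₖ (1 : Matrix (Fin P.dR) (Fin P.dR) ℂ)) := by
      rw [← Matrix.mul_kronecker_mul, Matrix.one_mul, Matrix.mul_one]
    rw [h2, Matrix.conjTranspose_mul]
    simp only [Matrix.mul_assoc]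
  rw [h1]
  simp only [pureOutput_mul_conjTranspose, attach_eq_sum, Matrix.mul_sum, Matrix.sum_mul,
    Finset.smul_sum, Matrix.mul_smul, Matrix.smul_mul, Matrix.conjTranspose_mul, Matrix.mul_assoc]
  simp only [Finset.sum_comm (s := (Finset.univ : Finset P.EnvA))
    (t := (Finset.univ : Finset (Fin 2))),
    Finset.sum_comm (s := (Finset.univ : Finset P.EnvB))
    (t := (Finset.univ : Finset (Fin 2)))]

lemma hsSq_pureOutput (x y : Bits n) (q : Fin 2) : hsSq (P.pureOutput x y q) = 1 := by
  have hW : ∑ e' : P.EnvB, ∑ e : P.EnvA, (P.aliceKraus x e ⊗ₖ P.bobKraus y e')ᴴ *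
      (P.aliceKraus x e ⊗ₖ P.bobKraus y e') = 1 := by
    simp only [Matrix.conjTranspose_kronecker, ← Matrix.mul_kronecker_mul]
    have h1 : ∀ e' : P.EnvB, ∑ e : P.EnvA, ((P.aliceKraus x e)ᴴ * P.aliceKraus x e) ⊗ₖ
        ((P.bobKraus y e')ᴴ * P.bobKraus y e') = (1 : Matrix _ _ ℂ) ⊗ₖ
        ((P.bobKraus y e')ᴴ * P.bobKraus y e') := by
      intro e'
      rw [← P.aliceKraus_sum x]
      ext a b
      simp only [Matrix.sum_apply, Matrix.kroneckerMap_apply, Finset.sum_mul]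
    simp only [h1]
    refine Eq.trans ?_ (Matrix.one_kronecker_one (α := ℂ))
    conv_rhs => rw [← P.bobKraus_sum y]
    ext a b
    simp only [Matrix.sum_apply, Matrix.kroneckerMap_apply, Finset.mul_sum]
  have hW' : ∑ w : P.EnvB × P.EnvA, (P.aliceKraus x w.2 ⊗ₖ P.bobKraus y w.1)ᴴ *
      (P.aliceKraus x w.2 ⊗ₖ P.bobKraus y w.1) = 1 := by
    rw [Fintype.sum_prod_type]; exact hW
  refine Eq.trans ?_ ((sum_hsSq_kraus_mul hW' _).trans (P.hsSq_attachBasis q))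
  simp only [hsSq]
  refine Eq.trans (Finset.sum_congr rfl fun m _ => ?_) Finset.sum_comm
  refine Eq.trans ?_ (Fintype.sum_prod_type (α₁ := P.EnvB) (α₂ := P.EnvA) _).symm
  refine (Fintype.sum_prod_type_right _).trans (Finset.sum_congr rfl fun e' _ => ?_)
  exact Fintype.sum_prod_type _

/-- On a 0-input, the environment almost distinguishes the basis states of the secret. -/
lemma nucBound_pureOutput_of_secure {f : Bits n → Bits n → Bool} {δ : ℝ} (hδ : 0 ≤ δ)
    (h : P.Secure f δ) {x y : Bits n} (hxy : f x y = false) :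
    NucBound (P.pureOutput x y 1 * (P.pureOutput x y 0)ᴴ) (2 * δ) := by
  obtain ⟨σ, hσ, hd⟩ := h x y hxy
  -- Polarisation: |1⟩⟨0| = ½ ∑ star z • phaseState z over the fourth roots of unity z. The terms in
  -- `σ` cancel since ∑ star z = 0, and four errors of δ/2 add up to `2 * δ`.
  have key : ∀ z : ℂ, star z * z = 1 → ‖z‖ = 1 →
      NucBound ((-(star z / 2)) • (σ - P.encode x y (phaseState z))) (δ / 2) := by
    intro z hz hz1
    have h1 := nucBound_of_diamondDist_le hδ hd (phaseState_isDensity hz)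
    have h2 : discardPrepare σ (phaseState z) = σ := by
      simp only [discardPrepare, LinearMap.smulRight_apply, Matrix.traceLinearMap_apply,
        (phaseState_isDensity hz).2, one_smul]
    rw [h2] at h1
    refine (h1.smul _).mono (le_of_eq ?_)
    rw [norm_neg, norm_div, norm_star, hz1]
    norm_num
    ring
  have h0 := (((key 1 (by simp) (by simp)).add (key (-1) (by simp) (by simp))).add
    ((key Complex.I (by simp) (by simp)).add (key (-Complex.I) (by simp) (by simp))))
  convert h0 using 1
  · simp only [encode_eq_sum, phaseState, Fin.sum_univ_two]
    simp
    have hI := Complex.I_sq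
    match_scalars <;> grind
  · ring

/-- The bit flip. -/
def bitFlip : Matrix (Fin 2) (Fin 2) ℂ := !![0, 1; 1, 0]

lemma bitFlip_conjTranspose : bitFlipᴴ = bitFlip := by
  ext i j
  fin_cases i <;> fin_cases j <;> simp [bitFlip]

lemma bitFlip_mul_self : bitFlip * bitFlip = 1 := by
  ext i j
  fin_cases i <;> fin_cases j <;> simp [bitFlip]

lemma norm_trace_bitFlip_mul_le {B : Matrix (Fin 2) (Fin 2) ℂ} {q : ℝ} (h : NucBound B q) :
    ‖(bitFlip * B).trace‖ ≤ q := by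
  have hq := h.nonneg
  obtain ⟨J, _, X, Y, rfl, hX, hY⟩ := h
  rw [← Matrix.mul_assoc, Matrix.trace_mul_comm]
  have h1 := norm_trace_conjTranspose_mul_le (X := Y) (Y := bitFlip * X) (a := Real.sqrt q)
    (b := Real.sqrt q) (by positivity) (by positivity) (by rwa [Real.sq_sqrt hq])
    (by rw [hsSq_isometry_mul (by rw [bitFlip_conjTranspose, bitFlip_mul_self]), Real.sq_sqrt hq]
        exact hX)
  rwa [Real.mul_self_sqrt hq] at h1

/-- Compressions of Hermitian unitaries are contractions. -/
lemma exists_complement_of_kraus {M Q J : Type} [Fintype M] [DecidableEq M] [Fintype Q]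
    [DecidableEq Q] [Fintype J] {K : J → Matrix Q M ℂ} (hK : ∑ j, (K j)ᴴ * K j = 1)
    {X : Matrix Q Q ℂ} (hX : Xᴴ = X) (hXX : X * X = 1) :
    ∃ C : Matrix M M ℂ,
      (∑ j, (K j)ᴴ * X * K j)ᴴ * (∑ j, (K j)ᴴ * X * K j) + Cᴴ * C = 1 := by
  classical
  set V : Matrix (J × Q) M ℂ := Matrix.of fun i p => K i.1 i.2 p with hVdef
  have hV : Vᴴ * V = 1 := by rw [← hK]; exact sum_conjTranspose_mul_self_eq_stack K
  set Y : Matrix (J × Q) (J × Q) ℂ := (1 : Matrix J J ℂ) ⊗ₖ X with hY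
  have hYY : Y * Y = 1 := by
    rw [hY, ← Matrix.mul_kronecker_mul, hXX, Matrix.one_mul, Matrix.one_kronecker_one]
  have hYH : Yᴴ = Y := by
    rw [hY, Matrix.conjTranspose_kronecker, hX, Matrix.conjTranspose_one]
  have hU : ∑ j, (K j)ᴴ * X * K j = Vᴴ * Y * V := by
    ext p q
    simp only [Matrix.sum_apply, Matrix.mul_apply, Matrix.conjTranspose_apply, hVdef, hY,
      Matrix.of_apply, Fintype.sum_prod_type, Matrix.kroneckerMap_apply]
    refine Finset.sum_congr rfl fun j _ => Finset.sum_congr rfl fun a _ => ?_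
    congr 1
    rw [Finset.sum_eq_single j (fun b _ hb => by simp [Matrix.one_apply_ne hb]) (by simp)]
    simp
  have hP : (1 - V * Vᴴ)ᴴ * (1 - V * Vᴴ) = 1 - V * Vᴴ := by
    have h1 : V * Vᴴ * (V * Vᴴ) = V * Vᴴ := by
      rw [Matrix.mul_assoc, ← Matrix.mul_assoc Vᴴ, hV, Matrix.one_mul]
    rw [Matrix.conjTranspose_sub, Matrix.conjTranspose_mul, Matrix.conjTranspose_conjTranspose,
      Matrix.conjTranspose_one, Matrix.sub_mul, Matrix.mul_sub, Matrix.mul_sub, h1]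
    simp
  -- Because `Y * Y = 1` and `Vᴴ * V = 1`, the defect of the compression is the Gram matrix of the
  -- part of `Y * V` outside the range of `V`, hence positive semidefinite.
  have h2 : 1 - (Vᴴ * Y * V)ᴴ * (Vᴴ * Y * V) =
      ((1 - V * Vᴴ) * (Y * V))ᴴ * ((1 - V * Vᴴ) * (Y * V)) := by
    have h3 : ((1 - V * Vᴴ) * (Y * V))ᴴ * ((1 - V * Vᴴ) * (Y * V)) =
        (Y * V)ᴴ * ((1 - V * Vᴴ)ᴴ * (1 - V * Vᴴ)) * (Y * V) := by
      rw [Matrix.conjTranspose_mul]; simp only [Matrix.mul_assoc]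
    have h4 : Vᴴ * Y * (Y * V) = 1 := by
      rw [Matrix.mul_assoc, ← Matrix.mul_assoc Y, hYY, Matrix.one_mul, hV]
    rw [h3, hP, Matrix.conjTranspose_mul Y, hYH, Matrix.mul_sub, Matrix.sub_mul, Matrix.mul_one, h4,
      Matrix.conjTranspose_mul, Matrix.conjTranspose_mul, hYH, Matrix.conjTranspose_conjTranspose]
    simp only [Matrix.mul_assoc]
  obtain ⟨C, hC⟩ := exists_eq_conjTranspose_mul_self
    (Matrix.posSemidef_conjTranspose_mul_self ((1 - V * Vᴴ) * (Y * V)))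
  refine ⟨C, ?_⟩
  rw [hU, ← hC, ← h2]
  simp

/-- On a 1-input, an operation on the messages almost maps the two basis states of the secret to
each other. -/
lemma exists_flip_of_correct {f : Bits n → Bits n → Bool} {ε : ℝ} (hε : 0 ≤ ε) (hε1 : ε ≤ 1)
    (h : P.Correct f ε) {x y : Bits n} (hxy : f x y = true) :
    ∃ U C : Matrix (Fin P.dA × Fin P.dB) (Fin P.dA × Fin P.dB) ℂ, Uᴴ * U + Cᴴ * C = 1 ∧
      (1 - ε) ^ 2 ≤ ‖((P.pureOutput x y 1)ᴴ * (U * P.pureOutput x y 0)).trace‖ ^ 2 := by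
  obtain ⟨D, hD⟩ := h x y hxy
  obtain ⟨m, K, hK, hK1⟩ := D.isChannel
  obtain ⟨C, hC⟩ := exists_complement_of_kraus hK1 bitFlip_conjTranspose bitFlip_mul_self
  refine ⟨_, C, hC, ?_⟩
  -- The Heisenberg dual of the decoder applied to the bit flip: its matrix element between pure
  -- outputs is the expectation of `bitFlip` after decoding. With `C` it forms a two-element Kraus
  -- family.
  set U := ∑ j, (K j)ᴴ * bitFlip * K j with hU
  have hdual : ∀ B C : Matrix (Fin P.dA × Fin P.dB) ((P.EnvA × P.EnvS) × P.EnvB) ℂ,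
      (Bᴴ * (U * C)).trace = (bitFlip * D.toLin (C * Bᴴ)).trace := by
    intro B C
    rw [hK, hU, Matrix.sum_mul, Matrix.mul_sum, Matrix.mul_sum, Matrix.trace_sum, Matrix.trace_sum]
    refine Finset.sum_congr rfl fun j _ => ?_
    have h1 : Bᴴ * ((K j)ᴴ * bitFlip * K j * C) = (Bᴴ * (K j)ᴴ) * (bitFlip * (K j * C)) := by
      simp only [Matrix.mul_assoc]
    rw [h1, Matrix.trace_mul_comm]
    simp only [Matrix.mul_assoc]
  have hUH : Uᴴ = U := by
    rw [hU, Matrix.conjTranspose_sum]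
    refine Finset.sum_congr rfl fun j _ => ?_
    simp only [Matrix.conjTranspose_mul, bitFlip_conjTranspose, Matrix.conjTranspose_conjTranspose,
      Matrix.mul_assoc]
  set z := ((P.pureOutput x y 1)ᴴ * (U * P.pureOutput x y 0)).trace with hz
  have hzz : star z = ((P.pureOutput x y 0)ᴴ * (U * P.pureOutput x y 1)).trace := by
    rw [hz, ← Matrix.trace_conjTranspose]
    simp only [Matrix.conjTranspose_mul, Matrix.conjTranspose_conjTranspose, hUH, Matrix.mul_assoc]
  -- |0⟩⟨1| + |1⟩⟨0| is the difference of the states |+⟩ and |-⟩, on which `bitFlip` has expectation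
  -- 1 and -1. Each survives decoding up to `ε`, so Re z ≥ 1 - ε.
  have hsum : z + star z =
      (bitFlip * (D.toLin ∘ₗ P.encode x y) (phaseState 1)).trace -
        (bitFlip * (D.toLin ∘ₗ P.encode x y) (phaseState (-1))).trace := by
    rw [hzz, hz, hdual, hdual, ← Matrix.trace_sub, ← Matrix.mul_sub, ← map_sub, ← Matrix.trace_add,
      ← Matrix.mul_add, ← map_add]
    congr 2
    rw [LinearMap.comp_apply]
    congr 1
    simp only [encode_eq_sum, phaseState, Fin.sum_univ_two, Matrix.sub_apply]
    simp
    module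
  have hb : ∀ w : ℂ, star w * w = 1 →
      ‖(bitFlip * (D.toLin ∘ₗ P.encode x y) (phaseState w)).trace -
        (bitFlip * phaseState w).trace‖ ≤ ε := by
    intro w hw
    rw [← Matrix.trace_sub, ← Matrix.mul_sub]
    exact norm_trace_bitFlip_mul_le (nucBound_of_diamondDist_le hε hD (phaseState_isDensity hw))
  have hp : (bitFlip * phaseState 1).trace = 1 := by
    norm_num [bitFlip, phaseState, Matrix.trace_fin_two]
  have hm : (bitFlip * phaseState (-1)).trace = -1 := by
    norm_num [bitFlip, phaseState, Matrix.trace_fin_two]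
  have h1 := (Complex.abs_re_le_norm _).trans (hb 1 (by simp))
  have h2 := (Complex.abs_re_le_norm _).trans (hb (-1) (by simp))
  rw [hp, Complex.sub_re, Complex.one_re, abs_le] at h1
  rw [hm, Complex.sub_re, Complex.neg_re, Complex.one_re, abs_le] at h2
  have h3 := congrArg Complex.re hsum
  rw [Complex.add_re, Complex.sub_re, Complex.star_def, Complex.conj_re] at h3
  have h4 : 1 - ε ≤ z.re := by linarith [h1.1, h2.2]
  have h5 : 1 - ε ≤ ‖z‖ := h4.trans (Complex.re_le_norm z)
  exact pow_le_pow_left₀ (by linarith) h5 2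

end CDQSProtocol

end QuantumCDS

end

noncomputable section

namespace QuantumCDS

/-! ### Elementary channels -/

section Channels

variable {ι κ ι' κ' J : Type} [Fintype ι] [DecidableEq ι] [Fintype κ] [DecidableEq κ]
  [Fintype ι'] [DecidableEq ι'] [Fintype κ'] [Fintype J]

/-- Renaming of the basis. -/
def equivChannel (e : ι ≃ κ) : Channel ι κ where
  toLin :=
    { toFun := fun X => X.submatrix e.symm e.symm
      map_add' := fun _ _ => rfl
      map_smul' := fun _ _ => rfl }
  isChannel := by
    refine ⟨1, fun _ => (1 : Matrix ι ι ℂ).submatrix e.symm id, fun X => ?_, ?_⟩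
    · have h : X.submatrix e.symm e.symm = (1 : Matrix ι ι ℂ).submatrix e.symm id * X *
          ((1 : Matrix ι ι ℂ).submatrix e.symm id)ᴴ := by
        ext a b
        simp [Matrix.mul_apply, Matrix.one_apply]
      rw [Fin.sum_univ_one]
      exact h
    · have h : ((1 : Matrix ι ι ℂ).submatrix e.symm id)ᴴ * (1 : Matrix ι ι ℂ).submatrix e.symm id =
          1 := by
        rw [Matrix.conjTranspose_submatrix, Matrix.submatrix_mul_equiv]
        simp
      rw [Fin.sum_univ_one]
      exact h

/-- The channel with given Kraus operators, up to renaming of bases. -/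
def krausChannel (f : ι ≃ ι') (g : κ ≃ κ') (K : J → Matrix κ' ι' ℂ)
    (hK : ∑ j, (K j)ᴴ * K j = 1) : Channel ι κ where
  toLin :=
    { toFun := fun X => (∑ j, K j * X.submatrix f.symm f.symm * (K j)ᴴ).submatrix g g
      map_add' := fun X Y => by
        simp only [Matrix.submatrix_add, Pi.add_apply, Matrix.mul_add, Matrix.add_mul,
          Finset.sum_add_distrib]
      map_smul' := fun c X => by
        simp only [Matrix.submatrix_smul, Pi.smul_apply, Matrix.mul_smul, Matrix.smul_mul,
          ← Finset.smul_sum, RingHom.id_apply] }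
  isChannel := by
    classical
    have e := Fintype.equivFin J
    refine ⟨Fintype.card J, fun j => (K (e.symm j)).submatrix g f, fun X => ?_, ?_⟩
    · change (∑ j, K j * X.submatrix f.symm f.symm * (K j)ᴴ).submatrix g g = _
      rw [Equiv.sum_comp e.symm (fun j => (K j).submatrix g f * X * ((K j).submatrix g f)ᴴ)]
      ext a b
      simp only [Matrix.submatrix_apply, Matrix.sum_apply]
      refine Finset.sum_congr rfl fun j _ => ?_
      have h : X = (X.submatrix f.symm f.symm).submatrix f f := by ext; simp
      conv_rhs => rw [h]
      rw [Matrix.conjTranspose_submatrix, Matrix.submatrix_mul_equiv, Matrix.submatrix_mul_equiv]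
      rfl
    · rw [Equiv.sum_comp e.symm (fun j => ((K j).submatrix g f)ᴴ * (K j).submatrix g f)]
      simp only [Matrix.conjTranspose_submatrix, Matrix.submatrix_mul_equiv]
      ext a b
      have := congrFun₂ hK (f a) (f b)
      simp only [Matrix.sum_apply, Matrix.submatrix_apply] at this ⊢
      rw [this]
      simp [Matrix.one_apply]

end Channels

/-! ### Verifiers in which Bob sends everything to Alice -/

section Verifier

variable {n : ℕ} (k : ℕ) (MA MB MA' MB' C : Type)
  [Fintype MA] [Fintype MB] [Fintype MA'] [Fintype MB'] [Fintype C]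
  [DecidableEq MA] [DecidableEq MB] [DecidableEq MA'] [DecidableEq MB'] [DecidableEq C]
  [Nonempty MA] [Nonempty MB] [Nonempty MA'] [Nonempty MB']

/-- Bob applies the isometry `V y` to what he received and sends the result to Alice, who measures
the effect `E x r`. -/
def oneMessageVerifiers (V : Bits n → Matrix C (MB × MB') ℂ) (hV : ∀ y, (V y)ᴴ * V y = 1)
    (E : Bits n → Bits k → Matrix ((MA × MA') × C) ((MA × MA') × C) ℂ)
    (hE : ∀ x r, (E x r).PosSemidef) (hE' : ∀ x r, (1 - E x r).PosSemidef) : QAMVerifiers n where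
  k := k
  mA := Fintype.card MA
  mB := Fintype.card MB
  mA' := Fintype.card MA'
  mB' := Fintype.card MB'
  mA_pos := Fintype.card_pos
  mB_pos := Fintype.card_pos
  mA'_pos := Fintype.card_pos
  mB'_pos := Fintype.card_pos
  -- The verifiers need no prior entanglement: the CDQS resource is contained in the state requested
  -- from the provers.
  dL := 1
  dR := 1
  shared := fun _ => 1
  shared_unit := by simp
  a := Fintype.card (MA × MA')
  b := Fintype.card C
  aliceInit := fun _ _ => equivChannel ((Equiv.prodUnique _ (Fin 1)).trans
    ((Equiv.prodCongr (Fintype.equivFin MA).symm (Fintype.equivFin MA').symm).trans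
      (Fintype.equivFin (MA × MA'))))
  bobInit := fun y => krausChannel (J := Unit) ((Equiv.prodUnique _ (Fin 1)).trans
    (Equiv.prodCongr (Fintype.equivFin MB).symm (Fintype.equivFin MB').symm))
    (Fintype.equivFin C).symm (fun _ => V y) (by simp [hV])
  -- Bob keeps a one-dimensional system, so only the system `C` is charged.
  interaction := .bobSends (Fintype.card ((MA × MA') × C)) 1 (Fintype.card C)
    (fun _ => equivChannel (Equiv.prodUnique _ (Fin 1)).symm)
    (fun _ _ => equivChannel ((Equiv.prodCongr (Fintype.equivFin (MA × MA')).symm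
      (Fintype.equivFin C).symm).trans (Fintype.equivFin ((MA × MA') × C))))
    (.output (fun x r => (E x r).submatrix (Fintype.equivFin _).symm (Fintype.equivFin _).symm)
      (fun x r => (hE x r).submatrix _) (fun x r => by
        have := (hE' x r).submatrix (Fintype.equivFin ((MA × MA') × C)).symm
        rwa [Matrix.submatrix_sub, Pi.sub_apply, Pi.sub_apply,
          Matrix.submatrix_one_equiv] at this))

/-- The name, among the verifiers' message systems, of a basis state of the four messages. -/
def messageEquiv : ((MA × MB) × (MA' × MB')) ≃
    ((Fin (Fintype.card MA) × Fin (Fintype.card MB)) ×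
      (Fin (Fintype.card MA') × Fin (Fintype.card MB'))) :=
  Equiv.prodCongr (Equiv.prodCongr (Fintype.equivFin MA) (Fintype.equivFin MB))
    (Equiv.prodCongr (Fintype.equivFin MA') (Fintype.equivFin MB'))

lemma trace_submatrix_kronecker_one_mul {X : Type} [Fintype X] {N : ℕ} (g : X ≃ Fin N)
    (E : Matrix X X ℂ) (ρ : Matrix (Fin N × Fin 1) (Fin N × Fin 1) ℂ) :
    ((E.submatrix g.symm g.symm ⊗ₖ (1 : Matrix (Fin 1) (Fin 1) ℂ)) * ρ).trace =
      (E * Matrix.of fun p q => ρ (g p, 0) (g q, 0)).trace := by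
  simp only [Matrix.trace, Matrix.diag_apply, Matrix.mul_apply, Fintype.sum_prod_type,
    Matrix.kroneckerMap_apply, Matrix.submatrix_apply, Matrix.of_apply, Fin.sum_univ_one]
  rw [← Equiv.sum_comp g]
  refine Finset.sum_congr rfl fun p _ => ?_
  rw [← Equiv.sum_comp g]
  simp

lemma oneMessageVerifiers_acceptProb (V : Bits n → Matrix C (MB × MB') ℂ)
    (hV : ∀ y, (V y)ᴴ * V y = 1)
    (E : Bits n → Bits k → Matrix ((MA × MA') × C) ((MA × MA') × C) ℂ)
    (hE : ∀ x r, (E x r).PosSemidef) (hE' : ∀ x r, (1 - E x r).PosSemidef)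
    (S : (oneMessageVerifiers k MA MB MA' MB' C V hV E hE hE').Strategy) (x y : Bits n)
    (r : Bits k) :
    (oneMessageVerifiers k MA MB MA' MB' C V hV E hE hE').interaction.acceptProb x y r
      (onRight ((oneMessageVerifiers k MA MB MA' MB' C V hV E hE hE').bobInit y).toLin
        (onLeft ((oneMessageVerifiers k MA MB MA' MB' C V hV E hE hE').aliceInit x r).toLin
          ((oneMessageVerifiers k MA MB MA' MB' C V hV E hE hE').jointState S r))) =
    (E x r * Matrix.of fun (p q : (MA × MA') × C) =>
      (V y * (Matrix.of fun (b b' : MB × MB') =>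
        (oneMessageVerifiers k MA MB MA' MB' C V hV E hE hE').proverState S r
          (messageEquiv MA MB MA' MB' ((p.1.1, b.1), (p.1.2, b.2)))
          (messageEquiv MA MB MA' MB' ((q.1.1, b'.1), (q.1.2, b'.2)))) * (V y)ᴴ) p.2 q.2).trace.re := by
  set σ := (oneMessageVerifiers k MA MB MA' MB' C V hV E hE hE').proverState S r
  -- The state before Alice merges her registers, entry by entry. Written as a function of the
  -- encoded indices, it matches the nested reindexings definitionally, and only cancellation of the
  -- encodings is left.
  let H : Fin (Fintype.card (MA × MA')) × Fin (Fintype.card C) →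
      Fin (Fintype.card (MA × MA')) × Fin (Fintype.card C) → ℂ := fun u w =>
    (∑ _ : Unit, V y * (Matrix.of fun b b' : MB × MB' =>
      σ (messageEquiv MA MB MA' MB' ((((Fintype.equivFin (MA × MA')).symm u.1).1, b.1),
          (((Fintype.equivFin (MA × MA')).symm u.1).2, b.2)))
        (messageEquiv MA MB MA' MB' ((((Fintype.equivFin (MA × MA')).symm w.1).1, b'.1),
          (((Fintype.equivFin (MA × MA')).symm w.1).2, b'.2))) * (1 * star 1)) * (V y)ᴴ)
      ((Fintype.equivFin C).symm u.2) ((Fintype.equivFin C).symm w.2)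
  change (((E x r).submatrix (Fintype.equivFin _).symm (Fintype.equivFin _).symm ⊗ₖ
    (1 : Matrix (Fin 1) (Fin 1) ℂ)) * _).trace.re = _
  rw [trace_submatrix_kronecker_one_mul]
  congr 3
  ext p q
  change H (Prod.map (Fintype.equivFin (MA × MA')) (Fintype.equivFin C)
      ((Fintype.equivFin ((MA × MA') × C)).symm (Fintype.equivFin ((MA × MA') × C) p)))
    (Prod.map (Fintype.equivFin (MA × MA')) (Fintype.equivFin C)
      ((Fintype.equivFin ((MA × MA') × C)).symm (Fintype.equivFin ((MA × MA') × C) q))) = _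
  simp only [H, Equiv.symm_apply_apply, Prod.map_fst, Prod.map_snd, star_one, mul_one,
    Finset.univ_unique, Finset.sum_singleton, Matrix.of_apply]

end Verifier

end QuantumCDS

end

noncomputable section

namespace QuantumCDS

/-! ### Verifiers testing independent copies -/

section CopiesVerifier

set_option linter.unusedSectionVars false

variable {A B A' B' C : Type} [Fintype A] [Fintype B] [Fintype A'] [Fintype B'] [Fintype C]
  [DecidableEq A] [DecidableEq B] [DecidableEq A'] [DecidableEq B'] [DecidableEq C]

/-- Bob's isometry, tensored with the identity on Alice's systems. -/
def liftIsometry (A A' : Type) [DecidableEq A] [DecidableEq A'] (V : Matrix C (B × B') ℂ) :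
    Matrix ((A × A') × C) ((A × B) × (A' × B')) ℂ :=
  Matrix.of fun p m => if p.1 = (m.1.1, m.2.1) then V p.2 (m.1.2, m.2.2) else 0

lemma sum_star_liftIsometry_mul (V : Matrix C (B × B') ℂ) (m : (A × B) × (A' × B'))
    (F : (A × A') × C → ℂ) :
    ∑ p, star (liftIsometry A A' V p m) * F p =
      ∑ c, star (V c (m.1.2, m.2.2)) * F ((m.1.1, m.2.1), c) := by
  rw [Fintype.sum_prod_type, Finset.sum_eq_single (m.1.1, m.2.1)
    (fun b _ hb => by simp [liftIsometry, hb]) (by simp)]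
  simp [liftIsometry]

lemma liftIsometry_isometry {V : Matrix C (B × B') ℂ} (hV : Vᴴ * V = 1) :
    (liftIsometry A A' V)ᴴ * liftIsometry A A' V = 1 := by
  ext m m'
  simp only [Matrix.mul_apply, Matrix.conjTranspose_apply]
  rw [sum_star_liftIsometry_mul]
  have h := congrFun₂ hV (m.1.2, m.2.2) (m'.1.2, m'.2.2)
  simp only [Matrix.mul_apply, Matrix.conjTranspose_apply] at h
  obtain ⟨⟨a, b⟩, ⟨a', b'⟩⟩ := m
  obtain ⟨⟨c, d⟩, ⟨c', d'⟩⟩ := m'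
  simp only [liftIsometry, Matrix.of_apply, Prod.mk.injEq, mul_ite, mul_zero] at h ⊢
  by_cases h1 : a = c ∧ a' = c'
  · simp only [if_pos h1]
    rw [h]
    simp only [Matrix.one_apply, Prod.mk.injEq, h1.1, h1.2, true_and]
  · simp only [if_neg h1, Finset.sum_const_zero, Matrix.one_apply, Prod.mk.injEq]
    rw [if_neg fun h => h1 ⟨h.1.1, h.2.1⟩]

/-- The hypothesis says φ = Vᴴχ. Hence measuring χ after Bob's isometry is the same as measuring φ
on the provers' messages. -/
lemma liftIsometry_conj_outer (V : Matrix C (B × B') ℂ) {χ : Matrix (A × A') C ℂ}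
    {φ : Matrix (A × B) (A' × B') ℂ}
    (h : ∀ m : (A × B) × (A' × B'),
      φ m.1 m.2 = ∑ c, star (V c (m.1.2, m.2.2)) * χ (m.1.1, m.2.1) c) :
    (liftIsometry A A' V)ᴴ * outer χ * liftIsometry A A' V = outer φ := by
  ext m m'
  rw [Matrix.mul_assoc]
  simp only [Matrix.mul_apply, Matrix.conjTranspose_apply]
  have h1 : ∀ m : (A × B) × (A' × B'), ∑ p, star (liftIsometry A A' V p m) * χ p.1 p.2 = φ m.1 m.2 := by
    intro m
    rw [sum_star_liftIsometry_mul, h]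
  have h2 : ∀ p, ∑ q, outer χ p q * liftIsometry A A' V q m' = χ p.1 p.2 * star (φ m'.1 m'.2) := by
    intro p
    rw [← h1 m', star_sum, Finset.mul_sum]
    refine Finset.sum_congr rfl fun q _ => ?_
    simp only [outer, Matrix.of_apply, star_mul', star_star]
    ring
  simp only [h2, ← mul_assoc]
  rw [← Finset.sum_mul, h1]
  rfl

variable {ι : Type} [Fintype ι] [DecidableEq ι]

/-- The identity pulls back to the identity because V is an isometry, so failures as well as
successes pull back copy by copy. -/
lemma thresholdOp_conj {V : Matrix C (B × B') ℂ} (hV : Vᴴ * V = 1) (T : ℕ)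
    {χ : ι → Matrix (A × A') C ℂ} {φ : ι → Matrix (A × B) (A' × B') ℂ}
    (h : ∀ i, ∀ m : (A × B) × (A' × B'),
      φ i m.1 m.2 = ∑ c, star (V c (m.1.2, m.2.2)) * χ i (m.1.1, m.2.1) c) :
    (piMat fun _ : ι => liftIsometry A A' V)ᴴ * thresholdOp T (fun i => outer (χ i)) *
      (piMat fun _ : ι => liftIsometry A A' V) = thresholdOp T fun i => outer (φ i) := by
  rw [thresholdOp, thresholdOp, Matrix.mul_sum, Matrix.sum_mul]
  refine Finset.sum_congr rfl fun S _ => ?_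
  rw [piMat_conjTranspose, piMat_mul, piMat_mul]
  congr 1
  funext i
  split_ifs
  · exact liftIsometry_conj_outer V (h i)
  · rw [Matrix.mul_sub, Matrix.sub_mul, Matrix.mul_one, liftIsometry_isometry hV,
      liftIsometry_conj_outer V (h i)]

/-- Pairs of families as families of pairs. -/
def zipEquiv (ι X Y : Type) : ((ι → X) × (ι → Y)) ≃ (ι → X × Y) :=
  (Equiv.arrowProdEquivProdArrow ι (fun _ => X) fun _ => Y).symm

/-- The systems of Alice, copy by copy. -/
def zipAlice (ι A A' C : Type) : (((ι → A) × (ι → A')) × (ι → C)) ≃ (ι → (A × A') × C) :=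
  (Equiv.prodCongr (zipEquiv ι A A') (Equiv.refl _)).trans (zipEquiv ι (A × A') C)

/-- Bob's isometry on all copies. -/
def copiesIsometry (ι : Type) [Fintype ι] (V : Matrix C (B × B') ℂ) :
    Matrix (ι → C) ((ι → B) × (ι → B')) ℂ :=
  (piMat fun _ : ι => V).submatrix id (zipEquiv ι B B')

lemma copiesIsometry_isometry {V : Matrix C (B × B') ℂ} (hV : Vᴴ * V = 1) :
    (copiesIsometry ι V)ᴴ * copiesIsometry ι V = 1 := by
  have h : (copiesIsometry ι V)ᴴ * copiesIsometry ι V =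
      ((piMat fun _ : ι => V)ᴴ * piMat fun _ : ι => V).submatrix (zipEquiv ι B B')
        (zipEquiv ι B B') := rfl
  rw [h, piMat_conjTranspose, piMat_mul, hV, piMat_one, Matrix.submatrix_one_equiv]

/-- Bob's isometry on all copies acts copy by copy. -/
lemma copiesIsometry_apply (V : Matrix C (B × B') ℂ) (v : Matrix (ι → A × B) (ι → A' × B') ℂ)
    (f : ι → (A × A') × C) :
    ∑ b : (ι → B) × (ι → B'), copiesIsometry ι V ((zipAlice ι A A' C).symm f).2 b *
      v (zipEquiv ι A B (((zipAlice ι A A' C).symm f).1.1, b.1))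
        (zipEquiv ι A' B' (((zipAlice ι A A' C).symm f).1.2, b.2)) =
    ((piMat fun _ : ι => liftIsometry A A' V) *ᵥ
      fun h : ι → (A × B) × (A' × B') => v (fun i => (h i).1) (fun i => (h i).2)) f := by
  rw [Matrix.mulVec, dotProduct]
  refine Eq.symm ?_
  rw [← Equiv.sum_comp (Equiv.arrowCongr (Equiv.refl ι) (Equiv.prodProdProdComm A A' B B')),
    ← Equiv.sum_comp (zipEquiv ι (A × A') (B × B')), Fintype.sum_prod_type,
    Finset.sum_eq_single (fun i => (f i).1)]
  · rw [← Equiv.sum_comp (zipEquiv ι B B')]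
    refine Finset.sum_congr rfl fun b _ => ?_
    congr 1
    simp only [piMat_apply, copiesIsometry, Matrix.submatrix_apply, id]
    refine Finset.prod_congr rfl fun i _ => ?_
    simp [liftIsometry, zipEquiv, zipAlice, Equiv.arrowProdEquivProdArrow]
  · intro u _ hu
    refine Finset.sum_eq_zero fun b _ => ?_
    obtain ⟨i, hi⟩ := Function.ne_iff.1 hu
    rw [piMat_apply, Finset.prod_eq_zero (Finset.mem_univ i), zero_mul]
    have : (f i).1 ≠ u i := Ne.symm hi
    simp [liftIsometry, zipEquiv, Equiv.arrowProdEquivProdArrow, this]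
  · simp

variable [Nonempty A] [Nonempty B] [Nonempty A'] [Nonempty B'] {n : ℕ}

/-- The verifiers test `K` copies, and accept if at least `T` tests succeed. -/
def copiesVerifiers (K T : ℕ) (V : Bits n → Matrix C (B × B') ℂ) (hV : ∀ y, (V y)ᴴ * V y = 1)
    (χ : Bits n → Bool → Matrix (A × A') C ℂ) (hχ : ∀ x b, hsSq (χ x b) = 1) : QAMVerifiers n :=
  oneMessageVerifiers K (Fin K → A) (Fin K → B) (Fin K → A') (Fin K → B') (Fin K → C)
    (fun y => copiesIsometry (Fin K) (V y)) (fun y => copiesIsometry_isometry (hV y))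
    (fun x r => (thresholdOp T fun i => outer (χ x (r i))).submatrix
      (zipAlice (Fin K) A A' C) (zipAlice (Fin K) A A' C))
    (fun x r => (thresholdOp_posSemidef T (fun i => outer_posSemidef _)
      fun i => one_sub_outer_posSemidef (hχ x (r i))).submatrix _)
    (fun x r => by
      have h := (one_sub_thresholdOp_posSemidef T (fun i => outer_posSemidef (χ x (r i)))
        fun i => one_sub_outer_posSemidef (hχ x (r i))).submatrix (zipAlice (Fin K) A A' C)
      rwa [Matrix.submatrix_sub, Pi.sub_apply, Pi.sub_apply, Matrix.submatrix_one_equiv] at h)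

/-- The name of a basis state of the messages of one prover. -/
def messageHalf (K : ℕ) (X Y : Type) [Fintype X] [Fintype Y] [DecidableEq X] [DecidableEq Y] :
    (Fin K → X × Y) ≃ Fin (Fintype.card (Fin K → X)) × Fin (Fintype.card (Fin K → Y)) :=
  (zipEquiv _ _ _).symm.trans
    (Equiv.prodCongr (Fintype.equivFin (Fin K → X)) (Fintype.equivFin (Fin K → Y)))

lemma trace_mul_sum_vecMulVec {X Θ : Type} [Fintype X] [Fintype Θ] (E : Matrix X X ℂ)
    (w : Θ → X → ℂ) :
    (E * ∑ t, Matrix.vecMulVec (w t) (star (w t))).trace = ∑ t, star (w t) ⬝ᵥ (E *ᵥ w t) := by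
  rw [Matrix.mul_sum, Matrix.trace_sum]
  refine Finset.sum_congr rfl fun t _ => ?_
  rw [Matrix.mul_vecMulVec, Matrix.trace_vecMulVec, dotProduct_comm]

/-- Removes the verifiers from the analysis: a strategy enters only through a decomposition of its
messages into vectors, and acceptance becomes the threshold test for φ. Soundness and completeness
both start from this formula. -/
lemma copiesVerifiers_acceptProb (K T : ℕ) (V : Bits n → Matrix C (B × B') ℂ)
    (hV : ∀ y, (V y)ᴴ * V y = 1)
    (χ : Bits n → Bool → Matrix (A × A') C ℂ) (hχ : ∀ x b, hsSq (χ x b) = 1)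
    (φ : Bits n → Bits n → Bool → Matrix (A × B) (A' × B') ℂ)
    (hφ : ∀ x y b, ∀ m : (A × B) × (A' × B'),
      φ x y b m.1 m.2 = ∑ c, star (V y c (m.1.2, m.2.2)) * χ x b (m.1.1, m.2.1) c)
    (S : (copiesVerifiers K T V hV χ hχ).Strategy) (x y : Bits n)
    {Θ : Bits K → Type} [∀ r, Fintype (Θ r)]
    (v : ∀ r, Θ r → Matrix (Fin K → A × B) (Fin K → A' × B') ℂ)
    (hv : ∀ (r : Bits K) μ ε μ' ε', (copiesVerifiers K T V hV χ hχ).proverState S r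
      (messageHalf K A B μ, messageHalf K A' B' ε) (messageHalf K A B μ', messageHalf K A' B' ε') =
        ∑ t, v r t μ ε * star (v r t μ' ε')) :
    (copiesVerifiers K T V hV χ hχ).acceptProb S x y =
      (∑ r : Bits K, ∑ t, ∑ S : Finset (Fin K) with T ≤ S.card,
        (quadForm (fun i => if i ∈ S then outer (φ x y (r i)) else 1 - outer (φ x y (r i)))
          (v r t)).re) / 2 ^ K := by
  unfold QAMVerifiers.acceptProb
  change (∑ r : Bits K, _) / (2 : ℝ) ^ K = _
  congr 1
  refine Finset.sum_congr rfl fun r _ => ?_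
  refine (oneMessageVerifiers_acceptProb _ _ _ _ _ _ _ _ _ _ _ S x y r).trans ?_
  set E := thresholdOp T fun i => outer (χ x (r i))
  set z := zipAlice (Fin K) A A' C
  set w : Θ r → ((Fin K → A) × (Fin K → A')) × (Fin K → C) → ℂ := fun t p =>
    ∑ b : (Fin K → B) × (Fin K → B'), copiesIsometry (Fin K) (V y) p.2 b *
      v r t (zipEquiv _ _ _ (p.1.1, b.1)) (zipEquiv _ _ _ (p.1.2, b.2)) with hw
  -- Bob's isometry acts on each vector of the decomposition separately, so Alice again receives a
  -- sum of rank one operators.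
  have hZ : (Matrix.of fun (p q : ((Fin K → A) × (Fin K → A')) × (Fin K → C)) =>
      (copiesIsometry (Fin K) (V y) * (Matrix.of fun (b b' : (Fin K → B) × (Fin K → B')) =>
        (copiesVerifiers K T V hV χ hχ).proverState S r
          (messageEquiv _ _ _ _ ((p.1.1, b.1), (p.1.2, b.2)))
          (messageEquiv _ _ _ _ ((q.1.1, b'.1), (q.1.2, b'.2)))) *
            (copiesIsometry (Fin K) (V y))ᴴ) p.2 q.2) =
      ∑ t, Matrix.vecMulVec (w t) (star (w t)) := by
    ext p q
    simp only [Matrix.of_apply, Matrix.sum_apply, Matrix.vecMulVec_apply, Pi.star_apply, hw,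
      star_sum, Matrix.mul_apply, Matrix.conjTranspose_apply]
    have hv' : ∀ b b' : (Fin K → B) × (Fin K → B'),
        (copiesVerifiers K T V hV χ hχ).proverState S r
          (messageEquiv _ _ _ _ ((p.1.1, b.1), (p.1.2, b.2)))
          (messageEquiv _ _ _ _ ((q.1.1, b'.1), (q.1.2, b'.2))) =
        ∑ t, v r t (zipEquiv _ _ _ (p.1.1, b.1)) (zipEquiv _ _ _ (p.1.2, b.2)) *
          star (v r t (zipEquiv _ _ _ (q.1.1, b'.1)) (zipEquiv _ _ _ (q.1.2, b'.2))) :=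
      fun b b' => hv r (zipEquiv _ _ _ (p.1.1, b.1)) (zipEquiv _ _ _ (p.1.2, b.2))
        (zipEquiv _ _ _ (q.1.1, b'.1)) (zipEquiv _ _ _ (q.1.2, b'.2))
    simp only [hv', Finset.sum_mul_sum]
    simp only [Finset.sum_mul, Finset.mul_sum, star_mul']
    refine Finset.sum_comm.trans (Eq.trans (Finset.sum_congr rfl fun b _ => ?_) Finset.sum_comm)
    refine Finset.sum_comm.trans ?_
    exact Finset.sum_congr rfl fun t _ => Finset.sum_congr rfl fun b' _ => by ring
  refine (congrArg (fun Z => (E.submatrix z z * Z).trace.re) hZ).trans ?_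
  rw [trace_mul_sum_vecMulVec, Complex.re_sum]
  refine Finset.sum_congr rfl fun t _ => ?_
  have h1 : star (w t) ⬝ᵥ (E.submatrix z z *ᵥ w t) =
      star (w t ∘ z.symm) ⬝ᵥ (E *ᵥ (w t ∘ z.symm)) := by
    rw [Matrix.submatrix_mulVec_equiv]
    simp only [dotProduct]
    rw [← Equiv.sum_comp z]
    simp
  have h2 : w t ∘ z.symm = (piMat fun _ : Fin K => liftIsometry A A' (V y)) *ᵥ
      fun h : Fin K → (A × B) × (A' × B') => v r t (fun i => (h i).1) (fun i => (h i).2) := by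
    funext f
    exact copiesIsometry_apply (V y) (v r t) f
  rw [h1, h2, Matrix.star_mulVec, Matrix.mulVec_mulVec, ← Matrix.dotProduct_mulVec,
    Matrix.mulVec_mulVec, ← Matrix.mul_assoc, thresholdOp_conj (hV y) T fun i => hφ x y (r i),
    thresholdOp, Matrix.sum_mulVec, dotProduct_sum, Complex.re_sum]
  exact Finset.sum_congr rfl fun S _ => by rw [quadForm_eq_dotProduct]

end CopiesVerifier

end QuantumCDS

end

noncomputable section

namespace QuantumCDS

/-! ### Soundness and completeness of the verifiers testing independent copies -/

/-- Allows the coin-independent channel of prover 2 to be applied before the coin-dependent one of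
prover 1. -/
lemma onRight_onLeft_comm {ι κ ι' κ' : Type} [Fintype ι] [DecidableEq ι] [Fintype κ]
    [DecidableEq κ] [Fintype ι'] [DecidableEq ι'] [Fintype κ'] [DecidableEq κ']
    {Φ : Matrix ι ι ℂ →ₗ[ℂ] Matrix κ κ ℂ} {Ψ : Matrix ι' ι' ℂ →ₗ[ℂ] Matrix κ' κ' ℂ}
    (hΦ : IsChannel Φ) (hΨ : IsChannel Ψ) (X : Matrix (ι' × ι) (ι' × ι) ℂ) :
    onRight Φ (onLeft Ψ X) = onLeft Ψ (onRight Φ X) := by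
  obtain ⟨m, K, hK, -⟩ := hΦ
  obtain ⟨m', K', hK', -⟩ := hΨ
  rw [onRight_eq_sum hK, onLeft_eq_sum hK', onLeft_eq_sum hK', onRight_eq_sum hK]
  simp only [Matrix.mul_sum, Matrix.sum_mul]
  rw [Finset.sum_comm]
  refine Finset.sum_congr rfl fun e' _ => Finset.sum_congr rfl fun e _ => ?_
  have h1 : ((1 : Matrix κ' κ' ℂ) ⊗ₖ K e) * (K' e' ⊗ₖ (1 : Matrix ι ι ℂ)) =
      (K' e' ⊗ₖ (1 : Matrix κ κ ℂ)) * ((1 : Matrix ι' ι' ℂ) ⊗ₖ K e) := by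
    simp only [← Matrix.mul_kronecker_mul, Matrix.one_mul, Matrix.mul_one]
  rw [← Matrix.mul_assoc, ← Matrix.mul_assoc, h1, Matrix.mul_assoc _ _ᴴ _ᴴ,
    ← Matrix.conjTranspose_mul, h1, Matrix.conjTranspose_mul]
  simp only [Matrix.mul_assoc]

/-! ### Strategies as Kraus operators acting on shared vectors -/

section Strategies

variable {k mA mB mA' mB' : ℕ}

/-- The state sent by the provers arises from finitely many vectors by operations of prover 1. -/
lemma ProverStrategy.exists_decomposition (S : ProverStrategy k mA mB mA' mB') :
    ∃ (m : Bits k → ℕ) (N : ∀ r, Fin (m r) → Matrix (Fin mA × Fin mB) (Fin S.p) ℂ)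
      (ω : Fin S.p × (Fin mA' × Fin mB') → Matrix (Fin S.p) (Fin mA' × Fin mB') ℂ),
      (∀ r, ∑ j, (N r j)ᴴ * N r j = 1) ∧ ∑ t, hsSq (ω t) = 1 ∧
      ∀ r s s', onRight S.prover2.toLin (onLeft (S.prover1 r).toLin S.state) s s' =
        ∑ j, ∑ t, (N r j * ω t) s.1 s.2 * star ((N r j * ω t) s'.1 s'.2) := by
  choose m G hG hG1 using fun r => (S.prover1 r).isChannel
  -- Absorbing prover 2 first leaves a state independent of the coins; the columns of a factor of it
  -- are the vectors `ω t`. That the `ω t` do not depend on `r` is where ignorance of the coins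
  -- enters.
  set τ := onRight S.prover2.toLin S.state with hτ
  have hτ0 : τ.PosSemidef := onRight_posSemidef S.prover2.isChannel S.state_isDensity.1
  have hτ1 : τ.trace = 1 := (trace_onRight S.prover2.isChannel _).trans S.state_isDensity.2
  obtain ⟨D, hD⟩ := exists_eq_mul_conjTranspose hτ0
  refine ⟨m, G, fun t => Matrix.of fun p e => D (p, e) t, hG1, ?_, fun r s s' => ?_⟩
  · have h1 : (hsSq D : ℂ) = 1 := by
      rw [← trace_conjTranspose_mul_self, Matrix.trace_mul_comm, ← hD, hτ1]
    have h2 : hsSq D = 1 := by exact_mod_cast h1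
    rw [← h2]
    simp only [hsSq, Matrix.of_apply]
    rw [Finset.sum_comm (f := fun a t => ‖D a t‖ ^ 2)]
    exact Finset.sum_congr rfl fun t _ =>
      (Fintype.sum_prod_type (α₁ := Fin S.p) fun a => ‖D a t‖ ^ 2).symm
  · have h2 : ∀ j (s : (Fin mA × Fin mB) × (Fin mA' × Fin mB')) t,
        ((G r j ⊗ₖ (1 : Matrix (Fin mA' × Fin mB') (Fin mA' × Fin mB') ℂ)) * D) s t =
          (G r j * Matrix.of fun p e => D (p, e) t) s.1 s.2 := by
      intro j s t
      simp only [Matrix.mul_apply, Matrix.of_apply]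
      refine (Fintype.sum_prod_type (α₁ := Fin S.p) _).trans (Finset.sum_congr rfl fun p _ => ?_)
      rw [Finset.sum_eq_single s.2 (fun b _ hb => by
        rw [Matrix.kroneckerMap_apply, Matrix.one_apply_ne (Ne.symm hb)]; simp) (by simp)]
      simp [Matrix.kroneckerMap_apply]
    rw [onRight_onLeft_comm S.prover2.isChannel (S.prover1 r).isChannel, onLeft_eq_sum (hG r),
      Matrix.sum_apply]
    refine Finset.sum_congr rfl fun j _ => ?_
    rw [← hτ, hD, ← Matrix.mul_assoc, Matrix.mul_assoc, ← Matrix.conjTranspose_mul,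
      Matrix.mul_apply]
    refine Finset.sum_congr rfl fun t _ => ?_
    rw [Matrix.conjTranspose_apply, h2, h2]

/-- The provers share the pure state `ω`, and prover 1 applies the Kraus operators `N r`. -/
lemma exists_strategy {X Y J : Type} [Fintype X] [DecidableEq X] [Fintype Y] [DecidableEq Y]
    [Fintype J] (eM : X ≃ Fin mA × Fin mB) (eE : Y ≃ Fin mA' × Fin mB') {ω : Matrix X Y ℂ}
    (hω : hsSq ω = 1) {N : Bits k → J → Matrix X X ℂ} (hN : ∀ r, ∑ j, (N r j)ᴴ * N r j = 1) :
    ∃ S : ProverStrategy k mA mB mA' mB', ∀ r μ ε μ' ε',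
      onRight S.prover2.toLin (onLeft (S.prover1 r).toLin S.state) (eM μ, eE ε) (eM μ', eE ε') =
        ∑ j, (N r j * ω) μ ε * star ((N r j * ω) μ' ε') := by
  let eP := Fintype.equivFin X
  let eP' := Fintype.equivFin Y
  refine ⟨
    { p := Fintype.card X
      p' := Fintype.card Y
      state := (outer ω).submatrix (Prod.map eP.symm eP'.symm) (Prod.map eP.symm eP'.symm)
      state_isDensity := by
        refine ⟨(outer_posSemidef ω).submatrix _, ?_⟩
        have h1 : (outer ω).trace = 1 := by
          have h2 : (outer ω).trace = (ωᴴ * ω).trace := by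
            rw [trace_conjTranspose_mul_eq_sum, ← Fintype.sum_prod_type']
            refine Finset.sum_congr rfl fun a _ => ?_
            simp only [Matrix.diag_apply, outer, Matrix.of_apply]
            ring
          rw [h2, trace_conjTranspose_mul_self, hω]
          simp
        rw [← h1]
        exact Equiv.sum_comp (Equiv.prodCongr eP.symm eP'.symm) fun a => outer ω a a
      prover1 := fun r => krausChannel eP.symm eM.symm (N r) (hN r)
      prover2 := equivChannel (eP'.symm.trans eE) }, fun r μ ε μ' ε' => ?_⟩
  change (∑ j, N r j * (Matrix.of fun f f' =>
    outer ω (eP.symm (eP f), eP'.symm (eP' (eE.symm (eE ε))))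
      (eP.symm (eP f'), eP'.symm (eP' (eE.symm (eE ε'))))) * (N r j)ᴴ)
    (eM.symm (eM μ)) (eM.symm (eM μ')) = _
  simp only [Equiv.symm_apply_apply]
  rw [Matrix.sum_apply]
  refine Finset.sum_congr rfl fun j _ => ?_
  simp only [Matrix.mul_apply, Matrix.conjTranspose_apply, Matrix.of_apply, outer, star_sum,
    Finset.sum_mul_sum]
  simp only [Finset.sum_mul, star_mul']
  rw [Finset.sum_comm]
  exact Finset.sum_congr rfl fun f _ => Finset.sum_congr rfl fun f' _ => by ring

end Strategies

/-! ### Acceptance bounds for the copies test -/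

section CopiesVerifier

variable {A B A' B' C : Type} [Fintype A] [Fintype B] [Fintype A'] [Fintype B'] [Fintype C]
  [DecidableEq A] [DecidableEq B] [DecidableEq A'] [DecidableEq B'] [DecidableEq C]
  [Nonempty A] [Nonempty B] [Nonempty A'] [Nonempty B'] {n : ℕ} (K T : ℕ)
  (V : Bits n → Matrix C (B × B') ℂ) (hV : ∀ y, (V y)ᴴ * V y = 1)
  (χ : Bits n → Bool → Matrix (A × A') C ℂ) (hχ : ∀ x b, hsSq (χ x b) = 1)
  (φ : Bits n → Bits n → Bool → Matrix (A × B) (A' × B') ℂ)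

theorem copiesVerifiers_acceptProb_le
    (hφ : ∀ x y b, ∀ m : (A × B) × (A' × B'),
      φ x y b m.1 m.2 = ∑ c, star (V y c (m.1.2, m.2.2)) * χ x b (m.1.1, m.2.1) c)
    (x y : Bits n) (hφ1 : ∀ b, hsSq (φ x y b) = 1) {F : ℝ}
    (hF : NucBound (φ x y true * (φ x y false)ᴴ) F)
    (S : (copiesVerifiers K T V hV χ hχ).Strategy) :
    (copiesVerifiers K T V hV χ hχ).acceptProb S x y ≤ (2 + F) ^ K / 3 ^ T := by
  obtain ⟨m, G, ω₀, hG1, hω1, hst⟩ := ProverStrategy.exists_decomposition (k := K)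
    (mA := Fintype.card (Fin K → A)) (mB := Fintype.card (Fin K → B))
    (mA' := Fintype.card (Fin K → A')) (mB' := Fintype.card (Fin K → B')) S
  set N : ∀ r : Bits K, Fin (m r) → Matrix (Fin K → A × B) (Fin S.p) ℂ := fun r j =>
    (G r j).submatrix (messageHalf K A B) id with hN
  have hN1 : ∀ r, ∑ j, (N r j)ᴴ * N r j = 1 := by
    intro r
    rw [← hG1 r]
    refine Finset.sum_congr rfl fun j _ => ?_
    simp only [hN, Matrix.conjTranspose_submatrix]
    exact Matrix.submatrix_mul_equiv _ _ _ _ _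
  set ω : (Fin S.p × (Fin (Fintype.card (Fin K → A')) × Fin (Fintype.card (Fin K → B')))) →
      Matrix (Fin S.p) (Fin K → A' × B') ℂ := fun t =>
    (ω₀ t).submatrix id (messageHalf K A' B') with hω
  have hacc := copiesVerifiers_acceptProb K T V hV χ hχ φ hφ S x y
    (Θ := fun r => Fin (m r) ×
      (Fin S.p × (Fin (Fintype.card (Fin K → A')) × Fin (Fintype.card (Fin K → B')))))
    (fun r t => N r t.1 * ω t.2) (fun r μ ε μ' ε' => by
      refine Eq.trans ?_ (Fintype.sum_prod_type (α₁ := Fin (m r)) _).symm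
      exact hst r (messageHalf K A B μ, messageHalf K A' B' ε)
        (messageHalf K A B μ', messageHalf K A' B' ε'))
  have hD1 : ∑ t, hsSq (ω t) = 1 := by
    rw [← hω1]
    refine Finset.sum_congr rfl fun t _ => Finset.sum_congr rfl fun p _ => ?_
    exact Equiv.sum_comp (messageHalf K A' B') fun e => ‖ω₀ t p e‖ ^ 2
  rw [hacc, div_le_div_iff₀ (by positivity) (by positivity)]
  calc _ = ∑ k, 3 ^ T * ∑ r : Bits K, ∑ j, ∑ S : Finset (Fin K) with T ≤ S.card,
        (quadForm (fun i => if i ∈ S then outer (φ x y (r i)) else 1 - outer (φ x y (r i)))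
          (N r j * ω k)).re := by
        rw [mul_comm, ← Finset.mul_sum]
        congr 1
        refine Eq.trans (Finset.sum_congr rfl fun r _ => ?_) Finset.sum_comm
        exact (Fintype.sum_prod_type (α₁ := Fin (m r)) _).trans Finset.sum_comm
    _ ≤ ∑ k, (4 + 2 * F) ^ K * hsSq (ω k) := by
        refine Finset.sum_le_sum fun k _ => ?_
        have := sum_threshold_le (φ x y) hφ1 hF T N hN1 (ω k)
        rwa [Fintype.card_fin] at this
    _ = (2 + F) ^ K * 2 ^ K := by
        rw [← Finset.mul_sum, hD1, ← mul_pow]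
        ring

theorem copiesVerifiers_exists_le_acceptProb
    (hφ : ∀ x y b, ∀ m : (A × B) × (A' × B'),
      φ x y b m.1 m.2 = ∑ c, star (V y c (m.1.2, m.2.2)) * χ x b (m.1.1, m.2.1) c)
    (L : ℕ) (x y : Bits n)
    (hφ1 : ∀ b, hsSq (φ x y b) = 1) {J : Type} [Fintype J]
    (N : Bool → J → Matrix (A × B) (A × B) ℂ)
    (hN : ∀ b, ∑ j, (N b j)ᴴ * N b j = 1) {p : Bool → ℝ}
    (hp : ∀ b, p b ≤ ∑ j, ‖((φ x y b)ᴴ * (N b j * φ x y false)).trace‖ ^ 2) :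
    ∃ S : (copiesVerifiers (4 * L) (3 * L) V hV χ hχ).Strategy,
      1 - (∑ b, (3 - 2 * p b)) ^ (4 * L) / (3 ^ L * 2 ^ (4 * L)) ≤
        (copiesVerifiers (4 * L) (3 * L) V hV χ hχ).acceptProb S x y := by
  classical
  set K := 4 * L with hK
  -- Honest provers share one copy of φ for coin `false` per test; prover 1 acts on each copy
  -- according to its coin.
  set ω : Matrix (Fin K → A × B) (Fin K → A' × B') ℂ := piMat fun _ => φ x y false with hω
  have hω1 : hsSq ω = 1 := by simp [hω, hsSq_piMat, hφ1]
  have hN' : ∀ r : Bits K, ∑ j : Fin K → J, (piMat fun i => N (r i) (j i))ᴴ *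
      (piMat fun i => N (r i) (j i)) = 1 := by
    intro r
    simp only [piMat_conjTranspose, piMat_mul]
    rw [← piMat_one]
    ext f g
    rw [Matrix.sum_apply]
    simp only [piMat_apply]
    have h := Finset.prod_univ_sum (fun _ : Fin K => (Finset.univ : Finset J))
      (fun i j => ((N (r i) j)ᴴ * N (r i) j) (f i) (g i))
    rw [Fintype.piFinset_univ] at h
    rw [← h]
    refine Finset.prod_congr rfl fun i _ => ?_
    rw [← hN (r i), Matrix.sum_apply]
  obtain ⟨S, hS⟩ := exists_strategy (k := K) (messageHalf K A B) (messageHalf K A' B') hω1 hN'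
  refine ⟨S, ?_⟩
  have hacc := copiesVerifiers_acceptProb K (3 * L) V hV χ hχ φ hφ S x y
    (Θ := fun _ => Fin K → J) (fun r j => piMat fun i => N (r i) (j i) * φ x y false)
    (fun r μ ε μ' ε' => by
      simp only [← piMat_mul]
      exact hS r μ ε μ' ε')
  have hrej := sum_not_threshold_le (ι := Fin K) (φ x y) hφ1 N hN L (by rw [Fintype.card_fin]) hp
  rw [Fintype.card_fin] at hrej
  -- The joint outcomes form a complete measurement, so acceptance is one minus the rejection
  -- probability that `sum_not_threshold_le` bounds.
  have htot : ∀ r : Bits K, ∑ j : Fin K → J, ∑ S : Finset (Fin K),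
      (quadForm (fun i => if i ∈ S then outer (φ x y (r i)) else 1 - outer (φ x y (r i)))
          (piMat fun i => N (r i) (j i) * φ x y false)).re = 1 := by
    intro r
    have h1 : ∀ j : Fin K → J, ∑ S : Finset (Fin K),
        (quadForm (fun i => if i ∈ S then outer (φ x y (r i)) else 1 - outer (φ x y (r i)))
          (piMat fun i => N (r i) (j i) * φ x y false)).re =
        ∏ i, hsSq (N (r i) (j i) * φ x y false) := by
      intro j
      rw [← Complex.re_sum, ← quadForm_add]
      simp only [add_sub_cancel, quadForm_piMat, quadOne_one]
      rw [← Complex.ofReal_prod, Complex.ofReal_re]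
    have h2 := Finset.prod_univ_sum (fun _ : Fin K => (Finset.univ : Finset J))
      (fun i j => hsSq (N (r i) j * φ x y false))
    rw [Fintype.piFinset_univ] at h2
    rw [Finset.sum_congr rfl fun j _ => h1 j, ← h2]
    simp [sum_hsSq_kraus_mul (hN _), hφ1]
  have hsplit : (∑ r : Bits K, ∑ j : Fin K → J, ∑ S : Finset (Fin K) with 3 * L ≤ S.card,
      (quadForm (fun i => if i ∈ S then outer (φ x y (r i)) else 1 - outer (φ x y (r i)))
          (piMat fun i => N (r i) (j i) * φ x y false)).re) +
      (∑ r : Bits K, ∑ j : Fin K → J, ∑ S : Finset (Fin K) with ¬ 3 * L ≤ S.card,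
      (quadForm (fun i => if i ∈ S then outer (φ x y (r i)) else 1 - outer (φ x y (r i)))
          (piMat fun i => N (r i) (j i) * φ x y false)).re) = 2 ^ K := by
    simp only [← Finset.sum_add_distrib, Finset.sum_filter_add_sum_filter_not, htot]
    simp
  rw [hacc, eq_sub_of_add_eq hsplit, sub_div, div_self (by positivity)]
  refine sub_le_sub_left ?_ 1
  rw [div_le_div_iff₀ (by positivity) (by positivity)]
  nlinarith [hrej, pow_pos (two_pos : (0 : ℝ) < 2) K]

end CopiesVerifier

end QuantumCDS

end

noncomputable section

namespace QuantumCDS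

/-! ### The proof system obtained from a CDQS protocol -/

lemma Channel.nonempty {ι κ : Type} [Fintype ι] [DecidableEq ι] [Fintype κ] (Φ : Channel ι κ)
    (i : ι) : Nonempty κ := by
  by_contra hc
  have hE : IsEmpty κ := not_nonempty_iff.1 hc
  obtain ⟨m, K, -, hK⟩ := Φ.isChannel
  have h := congrFun₂ hK i i
  simp [Matrix.sum_apply, Matrix.mul_apply] at h

namespace CDQSProtocol

variable {n : ℕ} (P : CDQSProtocol n)

/-- A resource of trace one excludes empty L or R, and trace preservation then excludes empty
outputs. The proof system requires nonempty messages, and the cost estimates need nonnegative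
logarithms. -/
lemma card_pos : (0 < P.dL ∧ 0 < P.dR) ∧ (0 < P.dA ∧ 0 < P.dB) := by
  have hLR : 0 < P.dL ∧ 0 < P.dR := by
    by_contra hc
    have hE : IsEmpty (Fin P.dL × Fin P.dR) :=
      ⟨fun p => hc ⟨Fin.pos p.1, Fin.pos p.2⟩⟩
    have h := P.resource_isDensity.2
    simp [Matrix.trace] at h
  refine ⟨hLR, ?_, ?_⟩
  · exact Fin.pos_iff_nonempty.2 ((P.alice fun _ => false).nonempty (0, ⟨0, hLR.1⟩))
  · exact Fin.pos_iff_nonempty.2 ((P.bob fun _ => false).nonempty ⟨0, hLR.2⟩)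

/-- Stinespring isometry of Bob's channels. -/
def bobStinespring (y : Bits n) : Matrix (Fin P.dB × P.EnvB) (Fin P.dR) ℂ :=
  Matrix.of fun m r => P.bobKraus y m.2 m.1 r

lemma bobStinespring_isometry (y : Bits n) : (P.bobStinespring y)ᴴ * P.bobStinespring y = 1 := by
  rw [← P.bobKraus_sum y]
  ext r r'
  simp only [Matrix.mul_apply, Matrix.sum_apply, Matrix.conjTranspose_apply, bobStinespring,
    Matrix.of_apply]
  exact Fintype.sum_prod_type_right _

/-- Bob undoes his Stinespring isometry, keeping what lies outside its range apart. -/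
def bobUndo (y : Bits n) : Matrix (Fin P.dR ⊕ (Fin P.dB × P.EnvB)) (Fin P.dB × P.EnvB) ℂ :=
  Matrix.fromRows (P.bobStinespring y)ᴴ (1 - P.bobStinespring y * (P.bobStinespring y)ᴴ)

lemma bobUndo_isometry (y : Bits n) : (P.bobUndo y)ᴴ * P.bobUndo y = 1 := by
  set V := P.bobStinespring y
  have h1 : V * Vᴴ * (V * Vᴴ) = V * Vᴴ := by
    rw [Matrix.mul_assoc, ← Matrix.mul_assoc Vᴴ, P.bobStinespring_isometry, Matrix.one_mul]
  rw [bobUndo, Matrix.conjTranspose_fromRows_eq_fromCols_conjTranspose,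
    Matrix.fromCols_mul_fromRows, Matrix.conjTranspose_conjTranspose, Matrix.conjTranspose_sub,
    Matrix.conjTranspose_mul, Matrix.conjTranspose_conjTranspose, Matrix.conjTranspose_one]
  change V * Vᴴ + (1 - V * Vᴴ) * (1 - V * Vᴴ) = 1
  rw [Matrix.sub_mul, Matrix.mul_sub, Matrix.mul_sub, h1]
  simp

/-- The state Alice expects after Bob's part has been undone. -/
def aliceTarget (x : Bits n) (q : Fin 2) :
    Matrix (Fin P.dA × (P.EnvA × P.EnvS)) (Fin P.dR ⊕ (Fin P.dB × P.EnvB)) ℂ :=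
  Matrix.of fun a => Sum.elim
    (fun r => ((P.aliceKraus x a.2.1 ⊗ₖ (1 : Matrix (Fin P.dR) (Fin P.dR) ℂ)) *
      P.attachBasis q) (a.1, r) a.2.2) fun _ => 0

lemma hsSq_aliceTarget (x : Bits n) (q : Fin 2) : hsSq (P.aliceTarget x q) = 1 := by
  have hW : ∑ e, (P.aliceKraus x e ⊗ₖ (1 : Matrix (Fin P.dR) (Fin P.dR) ℂ))ᴴ *
      (P.aliceKraus x e ⊗ₖ (1 : Matrix (Fin P.dR) (Fin P.dR) ℂ)) = 1 := by
    simp only [Matrix.conjTranspose_kronecker, ← Matrix.mul_kronecker_mul,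
      Matrix.conjTranspose_one, Matrix.one_mul]
    refine Eq.trans ?_ (Matrix.one_kronecker_one (α := ℂ))
    conv_rhs => rw [← P.aliceKraus_sum x]
    ext a b
    simp only [Matrix.sum_apply, Matrix.kroneckerMap_apply, Finset.sum_mul]
  refine Eq.trans ?_ ((sum_hsSq_kraus_mul hW _).trans (P.hsSq_attachBasis q))
  have h1 : hsSq (P.aliceTarget x q) = ∑ a : Fin P.dA, ∑ e : P.EnvA, ∑ g : P.EnvS,
      ∑ r : Fin P.dR, ‖((P.aliceKraus x e ⊗ₖ (1 : Matrix (Fin P.dR) (Fin P.dR) ℂ)) *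
        P.attachBasis q) (a, r) g‖ ^ 2 := by
    rw [hsSq]
    refine (Fintype.sum_prod_type (α₁ := Fin P.dA) _).trans (Finset.sum_congr rfl fun a _ => ?_)
    refine (Fintype.sum_prod_type (α₁ := P.EnvA) _).trans (Finset.sum_congr rfl fun e _ =>
      Finset.sum_congr rfl fun g _ => ?_)
    rw [Fintype.sum_sum_type]
    simp [aliceTarget]
  rw [h1, Finset.sum_comm]
  refine Finset.sum_congr rfl fun e _ => ?_
  rw [hsSq]
  refine Eq.trans ?_ (Fintype.sum_prod_type (α₁ := Fin P.dA) _).symm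
  exact Finset.sum_congr rfl fun a _ => Finset.sum_comm

/-- Alice's Kraus operators and Bob's Stinespring isometry act on different factors, and the first
block of `bobUndo` is the adjoint of the latter. Thus all dependence on y sits in Bob's operation,
as the locality of the verifiers demands. The target vanishes on the second block, which therefore
contributes nothing. -/
lemma pureOutput_eq_sum (x y : Bits n) (q : Fin 2)
    (m : (Fin P.dA × Fin P.dB) × ((P.EnvA × P.EnvS) × P.EnvB)) :
    P.pureOutput x y q m.1 m.2 =
      ∑ c, star (P.bobUndo y c (m.1.2, m.2.2)) * P.aliceTarget x q (m.1.1, m.2.1) c := by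
  obtain ⟨⟨a, b⟩, ⟨⟨e, g⟩, e'⟩⟩ := m
  have h2 : P.aliceKraus x e ⊗ₖ P.bobKraus y e' =
      ((1 : Matrix (Fin P.dA) (Fin P.dA) ℂ) ⊗ₖ P.bobKraus y e') *
        (P.aliceKraus x e ⊗ₖ (1 : Matrix (Fin P.dR) (Fin P.dR) ℂ)) := by
    rw [← Matrix.mul_kronecker_mul, Matrix.one_mul, Matrix.mul_one]
  rw [Fintype.sum_sum_type]
  change ((P.aliceKraus x e ⊗ₖ P.bobKraus y e') * P.attachBasis q) (a, b) g = _
  rw [h2, Matrix.mul_assoc, Matrix.mul_apply]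
  refine (Fintype.sum_prod_type (α₁ := Fin P.dA) _).trans ?_
  rw [Finset.sum_eq_single a (fun b _ hb => by
    refine Finset.sum_eq_zero fun r _ => ?_
    rw [Matrix.kroneckerMap_apply, Matrix.one_apply_ne (Ne.symm hb)]; simp) (by simp)]
  simp only [aliceTarget, Matrix.of_apply, Sum.elim_inl, Sum.elim_inr, mul_zero,
    Finset.sum_const_zero, add_zero]
  refine Finset.sum_congr rfl fun r _ => ?_
  simp [bobUndo, bobStinespring, Matrix.kroneckerMap_apply]

/-- The basis state of the secret tested on the coin `b`. -/
def coinBasis (b : Bool) : Fin 2 := if b then 1 else 0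

/-- The proof system that tests `4 * L` copies of the purified protocol. -/
def toVerifiers (L : ℕ) [Nonempty (Fin P.dA)] [Nonempty (Fin P.dB)] [Nonempty (P.EnvA × P.EnvS)]
    [Nonempty P.EnvB] : QAMVerifiers n :=
  copiesVerifiers (4 * L) (3 * L) P.bobUndo P.bobUndo_isometry
    (fun x b => P.aliceTarget x (coinBasis b)) (fun _ _ => P.hsSq_aliceTarget _ _)

variable (L : ℕ) [Nonempty (Fin P.dA)] [Nonempty (Fin P.dB)] [Nonempty (P.EnvA × P.EnvS)]
    [Nonempty P.EnvB]

theorem toVerifiers_secure {f : Bits n → Bits n → Bool} {δ : ℝ} (hδ : 0 ≤ δ)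
    (h : P.Secure f δ) {δ' : ℝ} (hδ' : (2 + 2 * δ) ^ (4 * L) / 3 ^ (3 * L) ≤ δ') :
    (P.toVerifiers L).Secure f δ' := by
  intro x y hxy S
  refine le_trans ?_ hδ'
  exact copiesVerifiers_acceptProb_le (4 * L) (3 * L) P.bobUndo P.bobUndo_isometry _ _
    (fun x y b => P.pureOutput x y (coinBasis b))
    (fun x y b m => P.pureOutput_eq_sum x y (coinBasis b) m) x y
    (fun b => P.hsSq_pureOutput x y _) (P.nucBound_pureOutput_of_secure hδ h hxy) S

theorem toVerifiers_correct {f : Bits n → Bits n → Bool} {ε : ℝ} (hε : 0 ≤ ε) (hε1 : ε ≤ 1)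
    (h : P.Correct f ε) {ε' : ℝ}
    (hε' : (4 - 2 * (1 - ε) ^ 2) ^ (4 * L) / (3 ^ L * 2 ^ (4 * L)) ≤ ε') :
    (P.toVerifiers L).Correct f ε' := by
  intro x y hxy
  obtain ⟨U, C, hUC, hU⟩ := P.exists_flip_of_correct hε hε1 h hxy
  obtain ⟨S, hS⟩ := copiesVerifiers_exists_le_acceptProb P.bobUndo P.bobUndo_isometry
    (fun x b => P.aliceTarget x (coinBasis b)) (fun _ _ => P.hsSq_aliceTarget _ _)
    (fun x y b => P.pureOutput x y (coinBasis b))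
    (fun x y b m => P.pureOutput_eq_sum x y (coinBasis b) m) L x y
    (fun b => P.hsSq_pureOutput x y _) (J := Bool)
    -- On coin 0 the shared state is already the target and nothing is done; the zero operator
    -- merely gives both coins the same Kraus index type. On coin 1 only the branch `U` is counted
    -- as success.
    (fun b j => if b then (if j then U else C) else (if j then 1 else 0))
    (by rintro (_ | _) <;> simp [hUC])
    (p := fun b => if b then (1 - ε) ^ 2 else 1) (by
      rintro (_ | _)
      · simp [coinBasis, trace_conjTranspose_mul_self, P.hsSq_pureOutput]
      · simp only [Fintype.sum_bool, if_true, coinBasis, Bool.false_eq_true, if_false]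
        exact hU.trans (le_add_of_nonneg_right (by positivity)))
  refine ⟨S, le_trans ?_ hS⟩
  refine sub_le_sub_left (le_trans (le_of_eq ?_) hε') 1
  simp only [Fintype.sum_bool, if_true, Bool.false_eq_true, if_false]
  congr 2
  ring

/-- Each of the `4 * L` copies costs at most 2 log dA + 4 log dB + 2 log dL + 3 log dR + 2. One of
the two extra qubits is the secret in Alice's environment, the other comes from the two blocks of
Bob's register. The public coins are not charged. -/
lemma toVerifiers_cost_le : (P.toVerifiers L).cost ≤ 4 * L * (4 * P.totalCost + 2) := by
  obtain ⟨⟨hL, hR⟩, hA, hB⟩ := P.card_pos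
  have hL' : (0 : ℝ) < P.dL := by exact_mod_cast hL
  have hR' : (0 : ℝ) < P.dR := by exact_mod_cast hR
  have hA' : (0 : ℝ) < P.dA := by exact_mod_cast hA
  have hB' : (0 : ℝ) < P.dB := by exact_mod_cast hB
  have h2 : Real.logb 2 2 = 1 := Real.logb_self_eq_one (by norm_num)
  have lL : 0 ≤ Real.logb 2 P.dL := Real.logb_nonneg (by norm_num) (by exact_mod_cast hL)
  have lA : 0 ≤ Real.logb 2 P.dA := Real.logb_nonneg (by norm_num) (by exact_mod_cast hA)
  have lB : 0 ≤ Real.logb 2 P.dB := Real.logb_nonneg (by norm_num) (by exact_mod_cast hB)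
  have lR : 0 ≤ Real.logb 2 P.dR := Real.logb_nonneg (by norm_num) (by exact_mod_cast hR)
  have e1 : Real.logb 2 (P.dA * (2 * P.dL) * (P.dL * P.dR)) =
      Real.logb 2 P.dA + (1 + Real.logb 2 P.dL) + (Real.logb 2 P.dL + Real.logb 2 P.dR) := by
    rw [Real.logb_mul (by positivity) (by positivity), Real.logb_mul (by positivity)
      (by positivity), Real.logb_mul (by positivity) (by positivity), Real.logb_mul (by positivity)
      (by positivity), h2]
  have e2 : Real.logb 2 (P.dB * P.dR) = Real.logb 2 P.dB + Real.logb 2 P.dR :=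
    Real.logb_mul (by positivity) (by positivity)
  -- Since `dB ≥ 1`, the block of size `dR` is no larger than the other one, and the sum at most
  -- doubles it.
  have e3 : Real.logb 2 (P.dR + P.dB * (P.dB * P.dR)) ≤
      1 + (Real.logb 2 P.dB + (Real.logb 2 P.dB + Real.logb 2 P.dR)) := by
    have hB1 : (1 : ℝ) ≤ P.dB := by exact_mod_cast hB
    calc _ ≤ Real.logb 2 (2 * (P.dB * (P.dB * P.dR))) := by
          refine Real.logb_le_logb_of_le (by norm_num) (by positivity) ?_
          nlinarith [mul_le_mul hB1 hB1 zero_le_one hB'.le]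
      _ = _ := by
          rw [Real.logb_mul (by positivity) (by positivity), Real.logb_mul (by positivity)
            (by positivity), e2, h2]
  have hcost : (P.toVerifiers L).cost = 4 * L * (Real.logb 2 P.dA + Real.logb 2 P.dB +
      Real.logb 2 (P.dA * (2 * P.dL) * (P.dL * P.dR)) + Real.logb 2 (P.dB * P.dR) +
      Real.logb 2 (P.dR + P.dB * (P.dB * P.dR))) := by
    change (Real.logb 2 (Fintype.card (Fin (4 * L) → Fin P.dA) : ℕ) +
      Real.logb 2 (Fintype.card (Fin (4 * L) → Fin P.dB) : ℕ) +
      Real.logb 2 (Fintype.card (Fin (4 * L) → P.EnvA × P.EnvS) : ℕ) +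
      Real.logb 2 (Fintype.card (Fin (4 * L) → P.EnvB) : ℕ)) +
      (Real.logb 2 (Fintype.card (Fin (4 * L) → Fin P.dR ⊕ (Fin P.dB × P.EnvB)) : ℕ) + 0) = _
    simp only [Fintype.card_fun, Fintype.card_fin, Fintype.card_prod, Fintype.card_sum]
    push_cast
    simp only [Real.logb_pow]
    push_cast
    ring
  rw [hcost, totalCost, e1, e2]
  refine mul_le_mul_of_nonneg_left ?_ (by positivity)
  linarith

end CDQSProtocol

end QuantumCDS

end

/-! ### Choice of the number of copies, and conclusion -/

theorem mainTheorem3 (εp δp : ℝ) (hε : εp ∈ Set.Ioo (0 : ℝ) 1) (hδ : δp ∈ Set.Ioo (0 : ℝ) 1) :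
    ∃ a c : ℝ, 0 < a ∧ 0 ≤ c ∧
      ∀ (n : ℕ) (f : QuantumCDS.Bits n → QuantumCDS.Bits n → Bool),
        QuantumCDS.cdqsBar 0.09 0.09 f ≥
          ENNReal.ofReal a * QuantumCDS.qam22 εp δp f - ENNReal.ofReal c := by
  -- For four copies the completeness and soundness bounds have bases of about 0.63 and 0.84. That
  -- both lie below 1 is the only use of the value 0.09.
  obtain ⟨L₁, hL₁⟩ := exists_pow_lt_of_lt_one hε.1
    (show (4 - 2 * (1 - 0.09 : ℝ) ^ 2) ^ 4 / (3 * 2 ^ 4) < 1 by norm_num)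
  obtain ⟨L₂, hL₂⟩ := exists_pow_lt_of_lt_one hδ.1
    (show (2 + 2 * 0.09 : ℝ) ^ 4 / 3 ^ 3 < 1 by norm_num)
  set L := max (max L₁ L₂) 1 with hL
  have hε' : (4 - 2 * (1 - 0.09 : ℝ) ^ 2) ^ (4 * L) / (3 ^ L * 2 ^ (4 * L)) ≤ εp := by
    rw [pow_mul, pow_mul, ← mul_pow, ← div_pow]
    refine le_trans ?_ hL₁.le
    exact pow_le_pow_of_le_one (by norm_num) (by norm_num) (by simp [hL])
  have hδ' : (2 + 2 * 0.09 : ℝ) ^ (4 * L) / 3 ^ (3 * L) ≤ δp := by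
    rw [pow_mul, pow_mul, ← div_pow]
    refine le_trans ?_ hL₂.le
    exact pow_le_pow_of_le_one (by norm_num) (by norm_num) (by simp [hL])
  have hL0 : (0 : ℝ) < L := by
    have : 0 < L := lt_of_lt_of_le one_pos (le_max_right _ _)
    exact_mod_cast this
  -- Solving `4 * L * (4 * t + 2)` for the protocol cost `t` gives both constants; `L` depends on
  -- `εp` and `δp` only. The maximum with 1 in `L` keeps the first constant positive.
  refine ⟨1 / (16 * L), 1 / 2, by positivity, by norm_num, fun n f => ?_⟩
  refine le_iInf fun P => le_iInf fun hC => le_iInf fun hS => ?_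
  obtain ⟨⟨h1, h2⟩, h3, h4⟩ := P.card_pos
  have : NeZero P.dL := ⟨h1.ne'⟩
  have : NeZero P.dR := ⟨h2.ne'⟩
  have : NeZero P.dA := ⟨h3.ne'⟩
  have : NeZero P.dB := ⟨h4.ne'⟩
  have hq : QuantumCDS.qam22 εp δp f ≤ ENNReal.ofReal (P.toVerifiers L).cost :=
    iInf_le_of_le (P.toVerifiers L) (iInf₂_le_of_le
      (P.toVerifiers_correct L (by norm_num) (by norm_num) hC hε')
      (P.toVerifiers_secure L (by norm_num) hS hδ') le_rfl)
  have hcost := P.toVerifiers_cost_le L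
  have ht : 0 ≤ P.totalCost := by
    refine add_nonneg (add_nonneg ?_ ?_) (add_nonneg ?_ ?_) <;>
      exact Real.logb_nonneg (by norm_num) (by exact_mod_cast ‹_›)
  rw [tsub_le_iff_right]
  calc _ ≤ ENNReal.ofReal (1 / (16 * L)) * ENNReal.ofReal (P.toVerifiers L).cost := by gcongr
    _ = ENNReal.ofReal (1 / (16 * L) * (P.toVerifiers L).cost) :=
        (ENNReal.ofReal_mul (by positivity)).symm
    _ ≤ ENNReal.ofReal (P.totalCost + 1 / 2) := by
        refine ENNReal.ofReal_le_ofReal ?_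
        calc _ ≤ 1 / (16 * L) * (4 * L * (4 * P.totalCost + 2)) := by gcongr
          _ = _ := by field_simp; ring
    _ = _ := ENNReal.ofReal_add ht (by norm_num)
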